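/- **Theorem 3.1 (with Corollary 3.2).** Let $H$ be a real separable Hilbert space, $U$ a real Hilbert space, $T>0$ and $X_0\in H$. Write $\|\cdot\|_2$ for the Hilbert–Schmidt norm on the space $L_2(U,H)$ of Hilbert–Schmidt operators from $U$ to $H$. Assume: 1. $A:D(A)\to H$ is a closed, densely defined linear operator that generates a $C_0$-semigroup $(S(t))_{t\ge 0}$ on $H$, and there is $\lambda>0$ with $\|S(t)\|\le e^{\lambda t}$ for all $t\ge 0$; 2. $f:H\to H$ is demicontinuous (if $x_n\to x$ strongly, then $f(x_n)\to f(x)$ weakly); 3. there are $m\in\mathbb N$ and $C_f$ with $\|f(x)\|\le C_f(1+\|x\|^m)$ for all $x\in H$; 4. there is $M\ge 0$ with $\langle f(x)-f(y),x-y\rangle\le M\|x-y\|^2$ for all $x,y\in H$; 5. $g:H\to L_2(U,H)$ satisfies $\|g(x)-g(y)\|_2\le D\|x-y\|$ for all $x,y\in H$, for some constant $D$. For $u\in L^2([0,T];U)$, call $z$ a continuous mild solution with control $u$ if $z:[0,T]\to H$ is continuous and $$z_t=S(t)X_0+\int_0^t S(t-s)\bigl(f(z_s)+g(z_s)u_s\bigr)\,ds\qquad\text{for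 all } t\in[0,T],$$ where the integrals exist as Bochner integrals. Then: (a) For every $u\in L^2([0,T];U)$ there is a continuous mild solution with control $u$. (b) There is a constant $C>0$, independent of $u$, such that for every $u\in L^2([0,T];U)$ and every continuous mild solution $z$ with control $u$, $$\|z_t\|^2\le C\exp\Bigl(\int_0^t\bigl(C+\|u_s\|_U^2\bigr)\,ds\Bigr)\qquad\text{for all } t\in[0,T].$$ (c) For every $N$ there is a constant $K$ such that for every $u\in L^2([0,T];U)$ with $\int_0^T\|u_s\|_U^2\,ds\le N$ and every continuous mild solution $z$ with control $u$, $$\|z_t\|\le K,\qquad \|f(z_t)\|\le K,\qquad \|g(z_t)\|_2\le K\qquad\text{for all } t\in[0,T].$$ In particular, these quantities are bounded uniformly in $n$ and $t$ along solutions $z^n$ with controls $u^n$ whenever $(u^n)$ converges in $L^2([0,T];U)$. -/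

import Mathlib

open Set Filter Topology MeasureTheory
open scoped ENNReal

/-- An index set for `stdHilbertBasis`. -/
noncomputable def stdHilbertBasisIndex (U : Type*) [NormedAddCommGroup U]
    [InnerProductSpace ℝ U] [CompleteSpace U] : Set U :=
  (exists_hilbertBasis ℝ U).choose

/-- An orthonormal (Hilbert) basis of a real Hilbert space `U`, indexed by a set of vectors. -/
noncomputable def stdHilbertBasis (U : Type*) [NormedAddCommGroup U] [InnerProductSpace ℝ U]
    [CompleteSpace U] : HilbertBasis (stdHilbertBasisIndex U) ℝ U :=
  (exists_hilbertBasis ℝ U).choose_spec.choose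

/-- The Hilbert-Schmidt norm `‖B‖₂ = (∑ ‖B eᵢ‖²)^{1/2}` of a bounded operator `B : U → H`,
with value `∞` if `B` is not Hilbert-Schmidt. It does not depend on the orthonormal
basis, see `hsNorm_eq`. -/
noncomputable def hsNorm {U H : Type*} [NormedAddCommGroup U] [InnerProductSpace ℝ U]
    [CompleteSpace U] [NormedAddCommGroup H] [InnerProductSpace ℝ H]
    (B : U →L[ℝ] H) : ℝ≥0∞ :=
  (∑' i, ‖B (stdHilbertBasis U i)‖ₑ ^ 2) ^ (1 / 2 : ℝ)

/-- `B` belongs to `L₂(U, H)`, i.e. `B` is a Hilbert-Schmidt operator. -/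
def IsHilbertSchmidt {U H : Type*} [NormedAddCommGroup U] [InnerProductSpace ℝ U]
    [CompleteSpace U] [NormedAddCommGroup H] [InnerProductSpace ℝ H]
    (B : U →L[ℝ] H) : Prop :=
  hsNorm B < ∞

theorem hilbertBasis_tsum_enorm_sq {ι V : Type*} [NormedAddCommGroup V]
    [InnerProductSpace ℝ V] (b : HilbertBasis ι ℝ V) (x : V) :
    ∑' i, ‖inner ℝ (b i) x‖ₑ ^ 2 = ‖x‖ₑ ^ 2 := by
  have h : HasSum (fun i => ‖inner ℝ (b i) x‖ ^ 2) (‖x‖ ^ 2) := by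
    have h1 := b.hasSum_inner_mul_inner x x
    rw [real_inner_self_eq_norm_sq] at h1
    have e : (fun i => ‖inner ℝ (b i) x‖ ^ 2)
        = fun i => inner ℝ x (b i) * inner ℝ (b i) x := by
      funext i
      rw [real_inner_comm (b i) x, Real.norm_eq_abs, sq_abs, sq]
    rw [e]
    exact h1
  have e : ∀ r : ℝ, ‖r‖ₑ ^ 2 = ENNReal.ofReal (‖r‖ ^ 2) := fun r => by
    rw [ENNReal.ofReal_pow (norm_nonneg r), ofReal_norm]
  simp_rw [e]
  rw [← ENNReal.ofReal_tsum_of_nonneg (fun i => by positivity) h.summable, h.tsum_eq,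
    ENNReal.ofReal_pow (norm_nonneg x), ofReal_norm]

theorem tsum_enorm_sq_eq_adjoint {ι κ U H : Type*} [NormedAddCommGroup U]
    [InnerProductSpace ℝ U] [CompleteSpace U] [NormedAddCommGroup H] [InnerProductSpace ℝ H]
    [CompleteSpace H] (B : U →L[ℝ] H) (b : HilbertBasis ι ℝ U) (c : HilbertBasis κ ℝ H) :
    ∑' i, ‖B (b i)‖ₑ ^ 2 = ∑' j, ‖(ContinuousLinearMap.adjoint B) (c j)‖ₑ ^ 2 := by
  simp_rw [← hilbertBasis_tsum_enorm_sq c (B _), ← hilbertBasis_tsum_enorm_sq b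
    ((ContinuousLinearMap.adjoint B) _)]
  rw [ENNReal.tsum_comm]
  simp_rw [ContinuousLinearMap.adjoint_inner_right]
  refine tsum_congr fun j => tsum_congr fun i => ?_
  rw [real_inner_comm]

/-- The Hilbert-Schmidt norm can be computed in any orthonormal basis. -/
theorem hsNorm_eq {ι U H : Type*} [NormedAddCommGroup U] [InnerProductSpace ℝ U]
    [CompleteSpace U] [NormedAddCommGroup H] [InnerProductSpace ℝ H] [CompleteSpace H]
    (B : U →L[ℝ] H) (b : HilbertBasis ι ℝ U) :
    hsNorm B = (∑' i, ‖B (b i)‖ₑ ^ 2) ^ (1 / 2 : ℝ) := by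
  rw [hsNorm, tsum_enorm_sq_eq_adjoint B (stdHilbertBasis U) (stdHilbertBasis H),
    tsum_enorm_sq_eq_adjoint B b (stdHilbertBasis H)]

/-- `(S t)_{t ≥ 0}` is a strongly continuous semigroup (C₀-semigroup) of bounded operators.
The values `S t` for `t < 0` are irrelevant. -/
structure IsC0Semigroup {H : Type*} [NormedAddCommGroup H] [NormedSpace ℝ H]
    (S : ℝ → H →L[ℝ] H) : Prop where
  zero : S 0 = ContinuousLinearMap.id ℝ H
  add : ∀ s t : ℝ, 0 ≤ s → 0 ≤ t → S (s + t) = (S s).comp (S t)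
  tendsto_zero : ∀ x : H, Tendsto (fun t => S t x) (𝓝[>] 0) (𝓝 x)

/-- The (possibly unbounded) operator `A` with domain `A.domain` is the infinitesimal generator
of `S`: `x ∈ D(A)` and `A x = y` iff `(S t x - x) / t → y` as `t ↓ 0`. -/
def IsGenerator {H : Type*} [NormedAddCommGroup H] [NormedSpace ℝ H]
    (A : H →ₗ.[ℝ] H) (S : ℝ → H →L[ℝ] H) : Prop :=
  ∀ x y : H, (x, y) ∈ A.graph ↔
    Tendsto (fun t : ℝ => t⁻¹ • (S t x - x)) (𝓝[>] 0) (𝓝 y)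

/-- Demicontinuity: `xₙ → x` strongly implies `f xₙ → f x` weakly. -/
def IsDemicontinuous {H : Type*} [NormedAddCommGroup H] [InnerProductSpace ℝ H]
    (f : H → H) : Prop :=
  ∀ (x : ℕ → H) (x₀ : H), Tendsto x atTop (𝓝 x₀) →
    ∀ v : H, Tendsto (fun n => inner ℝ (f (x n)) v) atTop (𝓝 (inner ℝ (f x₀) v))

/-- `z` is a continuous mild solution on `[0, T]` of
`dz/dt = A z + f(z) + g(z) u`, `z(0) = X₀`, that is, `z` is continuous on `[0, T]` and
`z_t = S(t) X₀ + ∫₀ᵗ S(t-s) (f(z_s) + g(z_s) u_s) ds` for all `t ∈ [0, T]`,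
the integrals being convergent Bochner integrals. -/
structure IsMildSolution {H U : Type*} [NormedAddCommGroup H] [InnerProductSpace ℝ H]
    [NormedAddCommGroup U] [InnerProductSpace ℝ U]
    (T : ℝ) (S : ℝ → H →L[ℝ] H) (f : H → H) (g : H → U →L[ℝ] H) (X₀ : H)
    (u : ℝ → U) (z : ℝ → H) : Prop where
  continuousOn : ContinuousOn z (Icc 0 T)
  integrable : ∀ t ∈ Icc 0 T,
    IntervalIntegrable (fun s => S (t - s) (f (z s) + g (z s) (u s))) volume 0 t
  eq : ∀ t ∈ Icc 0 T,
    z t = S t X₀ + ∫ s in (0 : ℝ)..t, S (t - s) (f (z s) + g (z s) (u s))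

/-! A mild solution need not take values in the domain of the generator, so `‖z‖ ^ 2` cannot be
differentiated. It is expanded over short time steps instead. The semigroup law gives `z t = P (t -
r) (z r) + I`, where `I` is the forcing integral over `[r, t]`. Hence `‖z t‖ ^ 2 ≤ ‖P (t - r) (z r)‖
^ 2 + 2 ⟪z t, I⟫`, the term `-‖I‖ ^ 2` being dropped. Weighting by `exp (-2 lam t)`, summing over a
mesh and refining it yields the energy inequality `exp_mul_sq_norm_mildSol_le`. The one-sided
Lipschitz bound on `f` and the Lipschitz bound on `g` control `⟪z, F⟫`, and Grönwall with an
integrable coefficient gives the a priori estimate (`sq_norm_mildSol_le`). The bounds on `f` and `g`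
along solutions follow from it.

For existence, a contraction argument is not available because `f` is only demicontinuous. An
exponential Euler scheme produces a path `y` and a mild solution driven by the drift along `y`,
uniformly close to `y` (`exists_approx_mildSol`). Truncating the drift to a ball makes the scheme
well defined, and the energy estimate shows that the truncation is never active
(`exists_bounded_approx_mildSol`). Applied to the difference of two approximations, the same
estimate makes them uniformly Cauchy (`exists_sq_norm_mildSol_sub_le`). The limit equation is
identified by testing against vectors, where weak convergence of `f (y n)` suffices. -/

/-! ### Scalar Grönwall inequality and measurability of demicontinuous maps. -/

/-- A Grönwall inequality with an integrable coefficient. -/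
theorem gronwall_integral_le {T B : ℝ} {a φ : ℝ → ℝ} (hB : 0 ≤ B)
    (ha : IntervalIntegrable a volume 0 T) (ha0 : ∀ s ∈ Icc 0 T, 0 ≤ a s)
    (hφ : ContinuousOn φ (Icc 0 T)) (hφ0 : ∀ s ∈ Icc 0 T, 0 ≤ φ s)
    (h : ∀ t ∈ Icc 0 T, φ t ≤ B + ∫ s in (0 : ℝ)..t, a s * φ s) :
    ∀ t ∈ Icc 0 T, φ t ≤ B * Real.exp (∫ s in (0 : ℝ)..t, a s) := by
  intro t ht
  have hT : 0 ≤ T := ht.1.trans ht.2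
  have huI : uIcc 0 T = Icc 0 T := uIcc_of_le hT
  have haφ : IntervalIntegrable (fun s => a s * φ s) volume 0 T :=
    ha.mul_continuousOn (by rwa [huI])
  set Φ : ℝ → ℝ := fun t => B + ∫ s in (0 : ℝ)..t, a s * φ s with hΦ
  set Λ : ℝ → ℝ := fun t => ∫ s in (0 : ℝ)..t, a s with hΛ
  have sub : ∀ {r s : ℝ}, r ∈ Icc 0 T → s ∈ Icc 0 T → uIcc r s ⊆ uIcc 0 T := by
    intro r s hr hs
    rw [huI]
    exact uIcc_subset_Icc hr hs
  have z0 : (0 : ℝ) ∈ Icc 0 T := ⟨le_rfl, hT⟩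
  have hΛc : ContinuousOn Λ (Icc 0 T) := by
    have := intervalIntegral.continuousOn_primitive_interval (μ := volume) (f := a) (a := 0) (b := T)
      (by rw [huI]; exact (intervalIntegrable_iff_integrableOn_Icc_of_le hT).1 ha)
    rwa [huI] at this
  have hΦc : ContinuousOn Φ (Icc 0 T) := by
    have := intervalIntegral.continuousOn_primitive_interval (μ := volume)
      (f := fun s => a s * φ s) (a := 0) (b := T)
      (by rw [huI]; exact (intervalIntegrable_iff_integrableOn_Icc_of_le hT).1 haφ)
    rw [huI] at this
    exact continuousOn_const.add this
  have hΛd : ∀ {r s : ℝ}, r ∈ Icc 0 T → s ∈ Icc 0 T → Λ s - Λ r = ∫ x in r..s, a x := by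
    intro r s hr hs
    exact intervalIntegral.integral_interval_sub_left (ha.mono_set (sub z0 hs))
      (ha.mono_set (sub z0 hr))
  have hΦd : ∀ {r s : ℝ}, r ∈ Icc 0 T → s ∈ Icc 0 T →
      Φ s - Φ r = ∫ x in r..s, a x * φ x := by
    intro r s hr hs
    have := intervalIntegral.integral_interval_sub_left (haφ.mono_set (sub z0 hs))
      (haφ.mono_set (sub z0 hr))
    simp only [hΦ]
    linarith
  have hΦmono : ∀ {r s : ℝ}, r ∈ Icc 0 T → s ∈ Icc 0 T → r ≤ s → Φ r ≤ Φ s := by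
    intro r s hr hs hrs
    have := hΦd hr hs
    have h2 : 0 ≤ ∫ x in r..s, a x * φ x := intervalIntegral.integral_nonneg hrs fun x hx =>
      mul_nonneg (ha0 x ⟨hr.1.trans hx.1, hx.2.trans hs.2⟩)
        (hφ0 x ⟨hr.1.trans hx.1, hx.2.trans hs.2⟩)
    linarith
  have hΛmono : ∀ {r s : ℝ}, r ∈ Icc 0 T → s ∈ Icc 0 T → r ≤ s → Λ r ≤ Λ s := by
    intro r s hr hs hrs
    have := hΛd hr hs
    have h2 : 0 ≤ ∫ x in r..s, a x := intervalIntegral.integral_nonneg hrs fun x hx =>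
      ha0 x ⟨hr.1.trans hx.1, hx.2.trans hs.2⟩
    linarith
  have hstep : ∀ {r s : ℝ}, r ∈ Icc 0 T → s ∈ Icc 0 T → r ≤ s →
      Φ s - Φ r ≤ (Λ s - Λ r) * Φ s := by
    intro r s hr hs hrs
    rw [hΦd hr hs, hΛd hr hs, ← intervalIntegral.integral_mul_const]
    refine intervalIntegral.integral_mono_on hrs (haφ.mono_set (sub hr hs))
      ((ha.mono_set (sub hr hs)).mul_const _) fun x hx => ?_
    have hx' : x ∈ Icc 0 T := ⟨hr.1.trans hx.1, hx.2.trans hs.2⟩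
    exact mul_le_mul_of_nonneg_left ((h x hx').trans (hΦmono hx' hs hx.2)) (ha0 x hx')
  have hΦ0 : Φ 0 = B := by simp [hΦ]
  have hΦnn : ∀ {s : ℝ}, s ∈ Icc 0 T → 0 ≤ Φ s := fun {s} hs => by
    have := hΦmono z0 hs hs.1
    linarith
  -- Since `a` is merely integrable, continuous induction replaces differentiation. The slack `q >
  -- 1` lets the bound propagate a little to the right of each point, and `q → 1` removes it at the
  -- end.
  have key : ∀ q : ℝ, 1 < q → Φ t ≤ B * Real.exp (q * Λ t) := by
    intro q hq
    have hsub : Icc 0 T ⊆ {x | Φ x ≤ B * Real.exp (q * Λ x)} := by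
      refine IsClosed.Icc_subset_of_forall_exists_gt ?_ ?_ ?_
      · rw [inter_comm]
        exact isClosed_Icc.isClosed_le hΦc
          (continuousOn_const.mul ((continuousOn_const.mul hΛc).rexp))
      · simp [hΦ, hΛ]
      · rintro r ⟨hr, hr'⟩ y hy
        have hrI : r ∈ Icc 0 T := Ico_subset_Icc_self hr'
        have hc : ContinuousWithinAt Λ (Icc 0 T) r := hΛc r hrI
        have hev : ∀ᶠ s in 𝓝[Icc 0 T] r, Λ s < Λ r + (q - 1) / q :=
          hc.eventually_lt_const (by
            have : 0 < (q - 1) / q := div_pos (by linarith) (by linarith)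
            linarith)
        have hev2 : ∀ᶠ s in 𝓝[>] r, Λ s < Λ r + (q - 1) / q := by
          refine nhdsWithin_le_of_mem ?_ hev
          filter_upwards [Ioo_mem_nhdsGT hr'.2] with s hs
          exact ⟨hr'.1.trans hs.1.le, hs.2.le⟩
        obtain ⟨s, hs1, hs2, hs3⟩ := (hev2.and (Filter.Eventually.and
          (Ioo_mem_nhdsGT hr'.2) (Ioo_mem_nhdsGT hy : Ioo r y ∈ 𝓝[>] r))).exists
        refine ⟨s, ?_, hs3.1, hs3.2.le⟩
        have hsI : s ∈ Icc 0 T := ⟨hr'.1.trans hs2.1.le, hs2.2.le⟩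
        have h1 := hstep hrI hsI hs2.1.le
        have h2 := hΛmono hrI hsI hs2.1.le
        set α := Λ s - Λ r with hα
        have hα0 : 0 ≤ α := by linarith
        have hα1 : q * α ≤ q - 1 := by
          have : α ≤ (q - 1) / q := by linarith
          calc q * α ≤ q * ((q - 1) / q) := by gcongr
            _ = q - 1 := by field_simp
        have h3 : Φ s ≤ Real.exp (q * α) * Φ r := by
          have e1 := Real.add_one_le_exp (q * α)
          -- `(1 + q α)(1 - α) = 1 + α (q - 1 - q α)`, which is at least `1` by the choice of `s`
          -- close to `r`.
          have e2 : 1 ≤ Real.exp (q * α) * (1 - α) := by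
            have : 0 ≤ 1 - α := by nlinarith
            nlinarith [mul_le_mul_of_nonneg_right e1 this]
          have e3 : (1 - α) * Φ s ≤ Φ r := by linarith
          have e4 := hΦnn hsI
          calc Φ s = 1 * Φ s := by ring
            _ ≤ (Real.exp (q * α) * (1 - α)) * Φ s := by gcongr
            _ = Real.exp (q * α) * ((1 - α) * Φ s) := by ring
            _ ≤ _ := by gcongr
        have h4 : Φ r ≤ B * Real.exp (q * Λ r) := hr
        calc Φ s ≤ Real.exp (q * α) * Φ r := h3
          _ ≤ Real.exp (q * α) * (B * Real.exp (q * Λ r)) := by gcongr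
          _ = B * Real.exp (q * α + q * Λ r) := by rw [Real.exp_add]; ring
          _ = B * Real.exp (q * Λ s) := by rw [hα]; ring_nf
    exact hsub ht
  have hlim : Tendsto (fun q : ℝ => B * Real.exp (q * Λ t)) (𝓝[>] 1)
      (𝓝 (B * Real.exp (1 * Λ t))) := by
    refine Tendsto.mono_left (Continuous.tendsto ?_ _) nhdsWithin_le_nhds
    fun_prop
  have := ge_of_tendsto hlim (by
    filter_upwards [self_mem_nhdsWithin] with q hq using key q hq)
  rw [one_mul] at this
  exact (h t ht).trans this

/-- A demicontinuous map into a separable Hilbert space is strongly measurable. -/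
theorem IsDemicontinuous.stronglyMeasurable {H : Type*} [NormedAddCommGroup H]
    [InnerProductSpace ℝ H] [CompleteSpace H] [TopologicalSpace.SeparableSpace H]
    [MeasurableSpace H] [BorelSpace H]
    {f : H → H} (hf : IsDemicontinuous f) : StronglyMeasurable f := by
  have : SecondCountableTopology H := UniformSpace.secondCountable_of_separable H
  obtain ⟨w, b, hb⟩ := exists_hilbertBasis ℝ H
  have hcont : ∀ v : H, Continuous fun x => inner ℝ v (f x) := fun v => by
    refine SeqContinuous.continuous fun x x₀ hx => ?_
    simpa only [real_inner_comm, Function.comp_def] using hf x x₀ hx v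
  -- Countability makes `atTop` on `Finset w` countably generated, as needed for limits of
  -- measurable maps. Basis vectors are `√2` apart, so balls of radius `1/2` are disjoint.
  have hcw : Countable w := by
    refine Pairwise.countable_of_isOpen_disjoint (s := fun i : w => Metric.ball (b i) (1 / 2))
      (fun i j hij => ?_) (fun i => Metric.isOpen_ball)
      (fun i => ⟨b i, Metric.mem_ball_self (by norm_num)⟩)
    refine Metric.ball_disjoint_ball ?_
    have h2 : ‖b i - b j‖ ^ 2 = 2 := by
      rw [norm_sub_sq_real, b.orthonormal.1, b.orthonormal.1, b.orthonormal.2 hij]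
      norm_num
    rw [dist_eq_norm]
    nlinarith [norm_nonneg (b i - b j)]
  refine stronglyMeasurable_of_tendsto (u := (atTop : Filter (Finset w)))
    (f := fun s x => ∑ i ∈ s, b.repr (f x) i • b i) (fun s => ?_) ?_
  · refine Finset.stronglyMeasurable_fun_sum _ fun i _ => ?_
    simp only [b.repr_apply_apply]
    exact ((hcont (b i)).smul continuous_const).stronglyMeasurable
  · rw [tendsto_pi_nhds]
    exact fun x => b.hasSum_repr (f x)

/-! ### Comparison and triangle inequalities for the Hilbert–Schmidt norm. -/

section HilbertSchmidt

variable {U H : Type*} [NormedAddCommGroup U] [InnerProductSpace ℝ U] [CompleteSpace U]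
  [NormedAddCommGroup H] [InnerProductSpace ℝ H]

/-- The operator norm is at most the Hilbert-Schmidt norm. -/
theorem enorm_le_hsNorm [CompleteSpace H] (B : U →L[ℝ] H) : ‖B‖ₑ ≤ hsNorm B := by
  by_cases htop : hsNorm B = ∞
  · simp [htop]
  have key : ‖B‖ ≤ (hsNorm B).toReal := by
    refine B.opNorm_le_of_unit_norm ENNReal.toReal_nonneg fun x hx => ?_
    -- A unit vector extends to an orthonormal basis, in which `‖B x‖ ^ 2` is a single term of the
    -- sum.
    have hx1 : Orthonormal ℝ ((↑) : ({x} : Set U) → U) := by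
      refine ⟨fun i => ?_, fun i j hij => absurd (Subsingleton.elim i j) hij⟩
      rw [Set.mem_singleton_iff.1 i.2, hx]
    obtain ⟨w, b, hw, hb⟩ := hx1.exists_hilbertBasis_extension
    have hxw : x ∈ w := hw rfl
    have hbx : b ⟨x, hxw⟩ = x := by rw [hb]
    have h1 : ‖B x‖ₑ ≤ hsNorm B := by
      rw [hsNorm_eq B b]
      calc ‖B x‖ₑ = (‖B (b ⟨x, hxw⟩)‖ₑ ^ 2) ^ (1 / 2 : ℝ) := by
            rw [hbx, ← ENNReal.rpow_natCast, ← ENNReal.rpow_mul]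
            norm_num
        _ ≤ _ := by
            gcongr
            exact ENNReal.le_tsum (f := fun i => ‖B (b i)‖ₑ ^ 2) ⟨x, hxw⟩
    rw [← toReal_enorm]
    exact ENNReal.toReal_mono htop h1
  rw [← ofReal_norm, ← ENNReal.ofReal_toReal htop]
  exact ENNReal.ofReal_le_ofReal key

theorem norm_le_of_hsNorm_le [CompleteSpace H] {B : U →L[ℝ] H} {c : ℝ} (hc : 0 ≤ c)
    (h : hsNorm B ≤ ENNReal.ofReal c) : ‖B‖ ≤ c := by
  have := (enorm_le_hsNorm B).trans h
  rwa [← ofReal_norm, ENNReal.ofReal_le_ofReal_iff hc] at this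

/-- The triangle inequality for the Hilbert-Schmidt norm, up to a constant. -/
theorem hsNorm_le_of_sub (B C : U →L[ℝ] H) : hsNorm B ≤ 2 * (hsNorm (B - C) + hsNorm C) := by
  -- The constant `2` would do; `4` is used because its square root is rational.
  have h1 : ∀ x, ‖B x‖ₑ ^ 2 ≤ 4 * (‖(B - C) x‖ₑ ^ 2 + ‖C x‖ₑ ^ 2) := by
    intro x
    have e : ‖B x‖ ^ 2 ≤ 4 * (‖(B - C) x‖ ^ 2 + ‖C x‖ ^ 2) := by
      have : ‖B x‖ ≤ ‖(B - C) x‖ + ‖C x‖ := by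
        calc ‖B x‖ = ‖(B - C) x + C x‖ := by simp
          _ ≤ _ := norm_add_le _ _
      nlinarith [norm_nonneg (B x), sq_nonneg (‖(B - C) x‖ - ‖C x‖), norm_nonneg ((B - C) x),
        norm_nonneg (C x)]
    have := ENNReal.ofReal_le_ofReal e
    rw [ENNReal.ofReal_mul (by norm_num), ENNReal.ofReal_add (by positivity) (by positivity),
      ENNReal.ofReal_pow (norm_nonneg _), ENNReal.ofReal_pow (norm_nonneg _),
      ENNReal.ofReal_pow (norm_nonneg _), ofReal_norm, ofReal_norm, ofReal_norm] at this
    simpa using this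
  have h2 : ∑' i, ‖B (stdHilbertBasis U i)‖ₑ ^ 2 ≤
      4 * (∑' i, ‖(B - C) (stdHilbertBasis U i)‖ₑ ^ 2 + ∑' i, ‖C (stdHilbertBasis U i)‖ₑ ^ 2) := by
    rw [← ENNReal.tsum_add, ← ENNReal.tsum_mul_left]
    exact ENNReal.tsum_le_tsum fun i => h1 _
  have h4 : (4 : ℝ≥0∞) ^ (1 / 2 : ℝ) = 2 := by
    rw [show (4 : ℝ≥0∞) = 2 ^ (2 : ℕ) by norm_num, ← ENNReal.rpow_natCast, ← ENNReal.rpow_mul]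
    norm_num
  unfold hsNorm
  calc _ ≤ (4 * (∑' i, ‖(B - C) (stdHilbertBasis U i)‖ₑ ^ 2
        + ∑' i, ‖C (stdHilbertBasis U i)‖ₑ ^ 2)) ^ (1 / 2 : ℝ) := by gcongr
    _ = 2 * (∑' i, ‖(B - C) (stdHilbertBasis U i)‖ₑ ^ 2
        + ∑' i, ‖C (stdHilbertBasis U i)‖ₑ ^ 2) ^ (1 / 2 : ℝ) := by
      rw [ENNReal.mul_rpow_of_nonneg _ _ (by norm_num), h4]
    _ ≤ _ := by
      gcongr
      exact ENNReal.rpow_add_le_add_rpow _ _ (by norm_num) (by norm_num)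

end HilbertSchmidt

/-! ### Semigroups with exponential bound and the variation of constants formula. -/

/-- A jointly continuous family `P` indexed by `ℝ` that is a semigroup for nonnegative times, with
`‖P t‖ ≤ exp (lam t)`. -/
structure IsExpSemigroup {H : Type*} [NormedAddCommGroup H] [NormedSpace ℝ H]
    (P : ℝ → H →L[ℝ] H) (lam : ℝ) : Prop where
  nonneg : 0 ≤ lam
  zero : P 0 = ContinuousLinearMap.id ℝ H
  add : ∀ s t : ℝ, 0 ≤ s → 0 ≤ t → P (s + t) = (P s).comp (P t)
  norm_le : ∀ t : ℝ, 0 ≤ t → ‖P t‖ ≤ Real.exp (lam * t)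
  cont : Continuous fun p : ℝ × H => P p.1 p.2

/-- The mild solution `P t x + ∫₀ᵗ P (t - s) (F s) ds` of `dz/dt = A z + F`, `z 0 = x`. -/
noncomputable def mildSol {H : Type*} [NormedAddCommGroup H] [NormedSpace ℝ H]
    (P : ℝ → H →L[ℝ] H) (x : H) (F : ℝ → H) (t : ℝ) : H :=
  P t x + ∫ s in (0 : ℝ)..t, P (t - s) (F s)

/-- A `C₀`-semigroup, extended by the identity to negative times. -/
theorem IsC0Semigroup.isExpSemigroup {H : Type*} [NormedAddCommGroup H] [NormedSpace ℝ H]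
    {S : ℝ → H →L[ℝ] H} {lam : ℝ} (hS : IsC0Semigroup S) (hlam : 0 ≤ lam)
    (hb : ∀ t : ℝ, 0 ≤ t → ‖S t‖ ≤ Real.exp (lam * t)) :
    IsExpSemigroup (fun t => S (max t 0)) lam := by
  refine ⟨hlam, by simpa using hS.zero, fun s t hs ht => ?_, fun t ht => ?_, ?_⟩
  · simp only [max_eq_left hs, max_eq_left ht, max_eq_left (add_nonneg hs ht)]
    exact hS.add s t hs ht
  · simp only [max_eq_left ht]
    exact hb t ht
  -- The absolute value turns right continuity at `0` into a two-sided limit. Factoring out the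
  -- earlier time then reduces continuity at any time to continuity at `0`.
  · have h0 : ∀ x, Tendsto (fun t => S |t| x) (𝓝 0) (𝓝 x) := by
      intro x
      have h1 : Tendsto (fun t => S t x) (𝓝[≥] 0) (𝓝 x) := by
        rw [← Ioi_insert, nhdsWithin_insert]
        refine Tendsto.sup ?_ (hS.tendsto_zero x)
        rw [tendsto_pure_left]
        intro s hs
        rw [hS.zero]
        exact mem_of_mem_nhds hs
      refine h1.comp (tendsto_nhdsWithin_iff.2 ⟨?_, .of_forall fun t => abs_nonneg t⟩)
      simpa using (continuous_abs.tendsto (0 : ℝ))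
    have h2 : ∀ x s t, 0 ≤ s → s ≤ t →
        ‖S t x - S s x‖ ≤ Real.exp (lam * s) * ‖S |t - s| x - x‖ := by
      intro x s t hs hst
      have e : S t x - S s x = S s (S |t - s| x - x) := by
        rw [map_sub, abs_of_nonneg (sub_nonneg.2 hst)]
        have := hS.add s (t - s) hs (sub_nonneg.2 hst)
        rw [add_sub_cancel] at this
        rw [this]
        rfl
      rw [e]
      exact ((S s).le_opNorm _).trans (by gcongr; exact hb s hs)
    have h3 : ∀ x s t, 0 ≤ s → 0 ≤ t →
        ‖S t x - S s x‖ ≤ Real.exp (lam * s) * ‖S |t - s| x - x‖ := by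
      intro x s t hs ht
      rcases le_total s t with h | h
      · exact h2 x s t hs h
      · rw [norm_sub_rev, abs_sub_comm]
        refine (h2 x t s ht h).trans ?_
        gcongr
    rw [continuous_iff_continuousAt]
    rintro ⟨t₀, x₀⟩
    set m : ℝ → ℝ := fun t => max t 0 with hm
    have hmc : Continuous m := continuous_id.max continuous_const
    have hm0 : ∀ t, 0 ≤ m t := fun t => le_max_right _ _
    -- Joint continuity: the change of vector is absorbed by the locally uniform norm bound, the
    -- change of time by strong continuity at the fixed vector `x₀`.
    have h4 : ∀ p : ℝ × H, ‖S (m p.1) p.2 - S (m t₀) x₀‖ ≤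
        Real.exp (lam * m p.1) * ‖p.2 - x₀‖ +
          Real.exp (lam * m t₀) * ‖S |m p.1 - m t₀| x₀ - x₀‖ := by
      intro p
      have e : S (m p.1) p.2 - S (m t₀) x₀
          = S (m p.1) (p.2 - x₀) + (S (m p.1) x₀ - S (m t₀) x₀) := by
        rw [map_sub]; abel
      rw [e]
      refine (norm_add_le _ _).trans (add_le_add ?_ (h3 _ _ _ (hm0 _) (hm0 _)))
      exact ((S _).le_opNorm _).trans (by gcongr; exact hb _ (hm0 _))
    rw [ContinuousAt, tendsto_iff_norm_sub_tendsto_zero]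
    refine squeeze_zero (fun _ => norm_nonneg _) h4 ?_
    have l1 : Tendsto (fun p : ℝ × H => Real.exp (lam * m p.1) * ‖p.2 - x₀‖) (𝓝 (t₀, x₀))
        (𝓝 (Real.exp (lam * m t₀) * ‖x₀ - x₀‖)) :=
      Continuous.tendsto (by fun_prop) (t₀, x₀)
    have l2 : Tendsto (fun p : ℝ × H => S |m p.1 - m t₀| x₀ - x₀) (𝓝 (t₀, x₀)) (𝓝 (x₀ - x₀)) := by
      refine Tendsto.sub_const ?_ _
      refine (h0 x₀).comp (f := fun p : ℝ × H => m p.1 - m t₀) ?_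
      have : Continuous fun p : ℝ × H => m p.1 - m t₀ := by fun_prop
      simpa using this.tendsto (t₀, x₀)
    have := l1.add (l2.norm.const_mul (Real.exp (lam * m t₀)))
    simpa using this

namespace IsExpSemigroup

variable {H : Type*} [NormedAddCommGroup H] [NormedSpace ℝ H] {P : ℝ → H →L[ℝ] H} {lam : ℝ}
  {x y : H} {F G : ℝ → H}

theorem norm_apply_le (hP : IsExpSemigroup P lam) {t b : ℝ} (ht : 0 ≤ t) (htb : t ≤ b) (x : H) :
    ‖P t x‖ ≤ Real.exp (lam * b) * ‖x‖ := by
  have := hP.nonneg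
  refine ((P t).le_opNorm _).trans ?_
  gcongr
  exact (hP.norm_le t ht).trans (by gcongr)

theorem aestronglyMeasurable_apply (hP : IsExpSemigroup P lam) {μ : Measure ℝ} {c : ℝ → ℝ}
    (hc : AEStronglyMeasurable c μ) (hF : AEStronglyMeasurable F μ) :
    AEStronglyMeasurable (fun s => P (c s) (F s)) μ :=
  hP.cont.comp_aestronglyMeasurable (hc.prodMk hF)

theorem aestronglyMeasurable_conv (hP : IsExpSemigroup P lam) {μ : Measure ℝ}
    (hF : AEStronglyMeasurable F μ) (t : ℝ) :
    AEStronglyMeasurable (fun s => P (t - s) (F s)) μ :=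
  hP.aestronglyMeasurable_apply
    (continuous_const.sub continuous_id).aestronglyMeasurable hF

theorem intervalIntegrable_conv (hP : IsExpSemigroup P lam) {a b t : ℝ}
    (hF : IntervalIntegrable F volume a b) (hab : a ≤ b) (hbt : b ≤ t) :
    IntervalIntegrable (fun s => P (t - s) (F s)) volume a b := by
  refine (hF.norm.const_mul (Real.exp (lam * (t - a)))).mono_fun
    (hP.aestronglyMeasurable_conv hF.aestronglyMeasurable_restrict_uIoc t) ?_
  refine (ae_restrict_iff' measurableSet_uIoc).2 (.of_forall fun s hs => ?_)
  rw [uIoc_of_le hab] at hs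
  refine (hP.norm_apply_le (b := t - a) (by linarith [hs.2]) (by linarith [hs.1]) _).trans
    (le_abs_self _)

theorem norm_integral_conv_le (hP : IsExpSemigroup P lam) {a b t : ℝ}
    (hF : IntervalIntegrable F volume a b) (hab : a ≤ b) (hbt : b ≤ t) :
    ‖∫ s in a..b, P (t - s) (F s)‖ ≤ Real.exp (lam * (t - a)) * ∫ s in a..b, ‖F s‖ := by
  rw [← intervalIntegral.integral_const_mul]
  refine (intervalIntegral.norm_integral_le_integral_norm hab).trans ?_
  refine intervalIntegral.integral_mono_on hab (hP.intervalIntegrable_conv hF hab hbt).norm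
    (hF.norm.const_mul _) fun s hs => ?_
  exact hP.norm_apply_le (by linarith [hs.2]) (by linarith [hs.1]) _

theorem mildSol_zero (hP : IsExpSemigroup P lam) : mildSol P x F 0 = x := by
  simp [mildSol, hP.zero]

theorem mildSol_sub (hP : IsExpSemigroup P lam) {t : ℝ} (ht : 0 ≤ t)
    (hF : IntervalIntegrable F volume 0 t) (hG : IntervalIntegrable G volume 0 t) :
    mildSol P x F t - mildSol P y G t = mildSol P (x - y) (fun s => F s - G s) t := by
  simp only [mildSol, map_sub]
  rw [intervalIntegral.integral_sub (hP.intervalIntegrable_conv hF ht le_rfl)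
    (hP.intervalIntegrable_conv hG ht le_rfl)]
  abel

/-- The semigroup law allows a mild solution to be restarted at time `r` from its value there. Both
the energy inequality and the Euler scheme rest on this. -/
theorem mildSol_eq_add [CompleteSpace H] (hP : IsExpSemigroup P lam) {r t : ℝ} (hr : 0 ≤ r)
    (hrt : r ≤ t) (hF : ∀ a b, IntervalIntegrable F volume a b) :
    mildSol P x F t = P (t - r) (mildSol P x F r) + ∫ s in r..t, P (t - s) (F s) := by
  have hadd : ∀ {a : ℝ}, 0 ≤ a → ∀ v, P (t - r) (P a v) = P (t - r + a) v := fun ha v => by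
    rw [hP.add _ _ (sub_nonneg.2 hrt) ha]; rfl
  simp only [mildSol]
  rw [map_add, hadd hr, ← ContinuousLinearMap.intervalIntegral_comp_comm _
    (hP.intervalIntegrable_conv (hF 0 r) hr le_rfl), sub_add_cancel, add_assoc,
    ← intervalIntegral.integral_add_adjacent_intervals
      (hP.intervalIntegrable_conv (hF 0 r) hr hrt) (hP.intervalIntegrable_conv (hF r t) hrt le_rfl)]
  congr 2
  refine intervalIntegral.integral_congr fun s hs => ?_
  rw [uIcc_of_le hr] at hs
  rw [hadd (by linarith [hs.2])]
  congr 2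
  ring

/-- Both the endpoint and the integrand depend on `t`. Cutting the integrand off after `t` gives an
integral over a fixed interval `[0, b]`, whose integrand is continuous in `t` at `t₀` except for `s
= t₀`; dominated convergence applies. -/
theorem continuousOn_mildSol (hP : IsExpSemigroup P lam)
    (hF : ∀ a b, IntervalIntegrable F volume a b) : ContinuousOn (mildSol P x F) (Ici 0) := by
  intro t₀ ht₀
  have ht₀' : (0 : ℝ) ≤ t₀ := ht₀
  have h1 : Continuous fun t => P t x := hP.cont.comp (continuous_id.prodMk continuous_const)
  refine ContinuousWithinAt.add h1.continuousWithinAt ?_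
  set b := t₀ + 1
  have hb : 0 ≤ b := by positivity
  have hev : ∀ᶠ t in 𝓝[Ici 0] t₀, t ∈ Icc 0 b := by
    filter_upwards [self_mem_nhdsWithin,
      nhdsWithin_le_nhds (Iio_mem_nhds (show t₀ < b by simp [b]))] with t h1 h2
    exact ⟨h1, le_of_lt h2⟩
  have key : ContinuousWithinAt
      (fun t => ∫ s in (0 : ℝ)..b, (Iic t).indicator (fun s => P (t - s) (F s)) s)
      (Ici 0) t₀ := by
    refine intervalIntegral.continuousWithinAt_of_dominated_interval
      (bound := fun s => Real.exp (lam * b) * ‖F s‖) ?_ ?_ ((hF 0 b).norm.const_mul _) ?_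
    · refine .of_forall fun t => ?_
      exact (hP.aestronglyMeasurable_conv (hF 0 b).aestronglyMeasurable_restrict_uIoc t).indicator
        measurableSet_Iic
    · filter_upwards [hev] with t ht
      refine .of_forall fun s hs => ?_
      rw [uIoc_of_le hb] at hs
      by_cases hst : s ≤ t
      · rw [indicator_of_mem (show s ∈ Iic t from hst)]
        exact hP.norm_apply_le (by linarith) (by linarith [hs.1, ht.2]) _
      · rw [indicator_of_notMem (show s ∉ Iic t from hst), norm_zero]
        positivity
    · have : ∀ᵐ s ∂(volume : Measure ℝ), s ≠ t₀ := by simp [ae_iff, measure_singleton]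
      filter_upwards [this] with s hs _
      refine ContinuousAt.continuousWithinAt ?_
      have hc : ContinuousAt (fun t => P (t - s) (F s)) t₀ := by
        refine Continuous.continuousAt (hP.cont.comp (f := fun t => (t - s, F s)) ?_)
        fun_prop
      rcases lt_or_gt_of_ne hs with h | h
      · refine hc.congr ?_
        filter_upwards [Ioi_mem_nhds h] with t ht
        rw [indicator_of_mem (mem_Iic.2 (le_of_lt ht))]
      · refine (continuousAt_const (y := (0 : H))).congr ?_
        filter_upwards [Iio_mem_nhds h] with t ht
        rw [indicator_of_notMem (notMem_Iic.2 ht)]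
  have heq : ∀ t ∈ Icc 0 b, ∫ s in (0 : ℝ)..t, P (t - s) (F s)
      = ∫ s in (0 : ℝ)..b, (Iic t).indicator (fun s => P (t - s) (F s)) s := by
    intro t ht
    exact (intervalIntegral.integral_indicator ht).symm
  refine key.congr_of_eventuallyEq ?_ (heq t₀ ⟨ht₀', by simp [b]⟩)
  filter_upwards [hev] with t ht using heq t ht

end IsExpSemigroup

/-! ### Energy inequality and Grönwall estimate for mild solutions. -/

namespace IsExpSemigroup

variable {H : Type*} [NormedAddCommGroup H] [InnerProductSpace ℝ H] [CompleteSpace H]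
  {P : ℝ → H →L[ℝ] H} {lam : ℝ} {x : H} {F : ℝ → H}

/-- With `z t = w + I` one has `‖z t‖ ^ 2 = ‖w‖ ^ 2 + 2 ⟪z t, I⟫ - ‖I‖ ^ 2`. Pairing `I` with the
right endpoint value gives the quadratic term a favourable sign. -/
theorem exp_mul_sq_norm_mildSol_step (hP : IsExpSemigroup P lam) {r t : ℝ} (hr : 0 ≤ r)
    (hrt : r ≤ t) (hF : ∀ a b, IntervalIntegrable F volume a b) :
    Real.exp (-(2 * lam * t)) * ‖mildSol P x F t‖ ^ 2 ≤
      Real.exp (-(2 * lam * r)) * ‖mildSol P x F r‖ ^ 2 +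
      ∫ s in r..t, 2 * Real.exp (-(2 * lam * t)) *
        inner ℝ (mildSol P x F t) (P (t - s) (F s)) := by
  have hz := hP.mildSol_eq_add (x := x) hr hrt hF
  set z := mildSol P x F with hzdef
  set I := ∫ s in r..t, P (t - s) (F s) with hI
  set w := P (t - r) (z r) with hw
  have hint : ∫ s in r..t, inner ℝ (z t) (P (t - s) (F s)) = inner ℝ (z t) I :=
    (innerSL ℝ (z t)).intervalIntegral_comp_comm (hP.intervalIntegrable_conv (hF r t) hrt le_rfl)
  rw [intervalIntegral.integral_const_mul, hint]
  have h1 : ‖z t‖ ^ 2 ≤ ‖w‖ ^ 2 + 2 * inner ℝ (z t) I := by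
    rw [hz, norm_add_sq_real, inner_add_left, real_inner_self_eq_norm_sq]
    nlinarith [sq_nonneg ‖I‖]
  have h2 : ‖w‖ ^ 2 ≤ Real.exp (2 * lam * (t - r)) * ‖z r‖ ^ 2 := by
    have := hP.norm_apply_le (sub_nonneg.2 hrt) le_rfl (z r)
    calc ‖w‖ ^ 2 ≤ (Real.exp (lam * (t - r)) * ‖z r‖) ^ 2 := by gcongr
      _ = _ := by rw [mul_pow, ← Real.exp_nat_mul]; push_cast; ring_nf
  have h3 : Real.exp (-(2 * lam * t)) * Real.exp (2 * lam * (t - r))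
      = Real.exp (-(2 * lam * r)) := by
    rw [← Real.exp_add]; ring_nf
  calc _ ≤ Real.exp (-(2 * lam * t)) *
        (Real.exp (2 * lam * (t - r)) * ‖z r‖ ^ 2 + 2 * inner ℝ (z t) I) := by
        gcongr; linarith
    _ = (Real.exp (-(2 * lam * t)) * Real.exp (2 * lam * (t - r))) * ‖z r‖ ^ 2 +
        2 * Real.exp (-(2 * lam * t)) * inner ℝ (z t) I := by ring
    _ = _ := by rw [h3]

/-- The energy inequality for mild solutions. -/
theorem exp_mul_sq_norm_mildSol_le (hP : IsExpSemigroup P lam) {t : ℝ} (ht : 0 ≤ t)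
    (hF : ∀ a b, IntervalIntegrable F volume a b) :
    Real.exp (-(2 * lam * t)) * ‖mildSol P x F t‖ ^ 2 ≤
      ‖x‖ ^ 2 + ∫ s in (0 : ℝ)..t, 2 * Real.exp (-(2 * lam * s)) *
        inner ℝ (mildSol P x F s) (F s) := by
  rcases ht.eq_or_lt with rfl | ht0
  · simp [hP.mildSol_zero]
  have hlam := hP.nonneg
  have hzc := hP.continuousOn_mildSol (x := x) hF
  have hstep := fun {r t : ℝ} (hr : 0 ≤ r) (hrt : r ≤ t) =>
    hP.exp_mul_sq_norm_mildSol_step (x := x) hr hrt hF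
  have hz0 : mildSol P x F 0 = x := hP.mildSol_zero
  generalize mildSol P x F = z at hzc hstep hz0 ⊢
  obtain ⟨Z, hZ⟩ := isCompact_Icc.exists_bound_of_continuousOn
    (hzc.mono (Icc_subset_Ici_self : Icc 0 t ⊆ Ici 0))
  have hZ0 : 0 ≤ Z := (norm_nonneg _).trans (hZ 0 ⟨le_rfl, ht⟩)
  -- `c h s` rounds `s` up to the mesh `h ℕ`, matching the right endpoints in the one-step
  -- inequality. `g h` glues the one-step integrands together.
  set c : ℝ → ℝ → ℝ := fun h s => h * (⌈s / h⌉₊ : ℝ) with hc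
  set g : ℝ → ℝ → ℝ := fun h s => 2 * Real.exp (-(2 * lam * c h s)) *
    inner ℝ (z (c h s)) (P (c h s - s) (F s)) with hg
  have hcge : ∀ {h s : ℝ}, 0 < h → s ≤ c h s := by
    intro h s hh
    have := Nat.le_ceil (s / h)
    rw [div_le_iff₀ hh] at this
    simp only [hc]
    linarith
  have hclt : ∀ {h s : ℝ}, 0 < h → 0 ≤ s → c h s ≤ s + h := by
    intro h s hh hs
    have := (Nat.ceil_lt_add_one (div_nonneg hs hh.le)).le
    calc c h s ≤ h * (s / h + 1) := by simp only [hc]; gcongr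
      _ = s + h := by field_simp
  have hcle : ∀ {h s : ℝ} {i : ℕ}, 0 < h → s ≤ i * h → c h s ≤ i * h := by
    intro h s i hh hs
    have : ⌈s / h⌉₊ ≤ i := Nat.ceil_le.2 (by rwa [div_le_iff₀ hh])
    have : ((⌈s / h⌉₊ : ℕ) : ℝ) ≤ i := by exact_mod_cast this
    simp only [hc]
    rw [mul_comm]
    gcongr
  have hc0 : ∀ {h s : ℝ}, 0 < h → 0 ≤ c h s := fun hh => by simp only [hc]; positivity
  have hceil : ∀ h : ℝ, Measurable fun s : ℝ => ⌈s / h⌉₊ := fun h =>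
    Nat.measurable_ceil.comp (measurable_id.div_const h)
  have hcm : ∀ h : ℝ, StronglyMeasurable (c h) := fun h => by
    have : Measurable (c h) :=
      (measurable_from_nat (f := fun k : ℕ => h * (k : ℝ))).comp (hceil h)
    exact this.stronglyMeasurable
  have hzm : ∀ h : ℝ, StronglyMeasurable fun s => z (c h s) := fun h =>
    (StronglyMeasurable.of_discrete (f := fun k : ℕ => z (h * (k : ℝ)))).comp_measurable
      (hceil h)
  have hgm : ∀ h a b, AEStronglyMeasurable (g h) (volume.restrict (uIoc a b)) := by
    intro h a b
    refine AEStronglyMeasurable.mul ?_ ((hzm h).aestronglyMeasurable.inner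
      (hP.aestronglyMeasurable_apply ((hcm h).sub
        stronglyMeasurable_id).aestronglyMeasurable (hF a b).aestronglyMeasurable_restrict_uIoc))
    have : Continuous fun c : ℝ => 2 * Real.exp (-(2 * lam * c)) := by fun_prop
    exact (this.comp_stronglyMeasurable (hcm h)).aestronglyMeasurable
  -- A mesh-independent bound for dominated convergence. The condition `n * h = t` keeps the rounded
  -- time inside `[0, t]`, where `z` is bounded by `Z`.
  have hgb : ∀ {n : ℕ} {h s : ℝ}, 0 < h → h ≤ t → n * h = t → s ∈ Ioc 0 t →
      ‖g h s‖ ≤ 2 * Z * Real.exp (lam * t) * ‖F s‖ := by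
    intro n h s hh hht hn hs
    have h1 : ‖z (c h s)‖ ≤ Z := hZ _ ⟨hc0 hh, hn ▸ hcle hh (hn ▸ hs.2)⟩
    have h2 : ‖P (c h s - s) (F s)‖ ≤ Real.exp (lam * t) * ‖F s‖ :=
      hP.norm_apply_le (sub_nonneg.2 (hcge hh)) (by linarith [hclt hh hs.1.le]) _
    have h3 : Real.exp (-(2 * lam * c h s)) ≤ 1 := by
      rw [Real.exp_le_one_iff]
      have : 0 ≤ lam * c h s := mul_nonneg hlam (hc0 hh)
      linarith
    calc ‖g h s‖ = 2 * Real.exp (-(2 * lam * c h s)) *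
          ‖inner ℝ (z (c h s)) (P (c h s - s) (F s))‖ := by
            simp only [hg]
            rw [norm_mul, Real.norm_of_nonneg (by positivity)]
      _ ≤ 2 * 1 * (Z * (Real.exp (lam * t) * ‖F s‖)) := by
            gcongr
            exact (norm_inner_le_norm _ _).trans (by gcongr)
      _ = _ := by ring
  have hgint : ∀ {n : ℕ} {h : ℝ}, 0 < h → h ≤ t → n * h = t →
      IntervalIntegrable (g h) volume 0 t := by
    intro n h hh hht hn
    refine ((hF 0 t).norm.const_mul (2 * Z * Real.exp (lam * t))).mono_fun (hgm h 0 t) ?_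
    refine (ae_restrict_iff' measurableSet_uIoc).2 (.of_forall fun s hs => ?_)
    rw [uIoc_of_le ht] at hs
    exact (hgb hh hht hn hs).trans (le_abs_self _)
  have hdisc : ∀ n : ℕ, 0 < n → Real.exp (-(2 * lam * t)) * ‖z t‖ ^ 2 ≤
      ‖x‖ ^ 2 + ∫ s in (0 : ℝ)..t, g (t / n) s := by
    intro n hn
    have hn' : (0 : ℝ) < n := by exact_mod_cast hn
    have hn1 : (1 : ℝ) ≤ n := by exact_mod_cast hn
    set h := t / n with hh
    have hh0 : 0 < h := by positivity
    have hnh : n * h = t := by rw [hh]; field_simp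
    have hht : h ≤ t := by
      rw [← hnh]
      nlinarith
    have hgi := hgint hh0 hht hnh
    have ind : ∀ i : ℕ, i ≤ n → Real.exp (-(2 * lam * (i * h))) * ‖z (i * h)‖ ^ 2 ≤
        ‖x‖ ^ 2 + ∫ s in (0 : ℝ)..(i * h), g h s := by
      intro i
      induction i with
      | zero => intro _; simp [hz0]
      | succ i ih =>
        intro hi
        have hi' : ((i + 1 : ℕ) : ℝ) ≤ n := by exact_mod_cast hi
        have hle : (i : ℝ) * h ≤ (i + 1 : ℕ) * h := by gcongr; simp
        have hi0 : 0 ≤ (i : ℝ) * h := by positivity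
        have hit : ((i + 1 : ℕ) : ℝ) * h ≤ t := by rw [← hnh]; gcongr
        refine (hstep hi0 hle).trans ?_
        have e1 : ∫ s in (i * h)..((i + 1 : ℕ) * h), 2 * Real.exp (-(2 * lam * ((i + 1 : ℕ) * h))) *
            inner ℝ (z ((i + 1 : ℕ) * h)) (P ((i + 1 : ℕ) * h - s) (F s))
            = ∫ s in (i * h)..((i + 1 : ℕ) * h), g h s := by
          refine intervalIntegral.integral_congr_ae (.of_forall fun s hs => ?_)
          rw [uIoc_of_le hle] at hs
          have : c h s = (i + 1 : ℕ) * h := by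
            have : ⌈s / h⌉₊ = i + 1 := by
              rw [Nat.ceil_eq_iff (by simp), lt_div_iff₀ hh0, div_le_iff₀ hh0]
              exact ⟨by simpa using hs.1, hs.2⟩
            simp only [hc]
            rw [this, mul_comm]
          simp only [hg]
          rw [this]
        rw [e1, ← intervalIntegral.integral_add_adjacent_intervals (a := 0) (b := i * h)
          (hgi.mono_set ?_) (hgi.mono_set ?_), ← add_assoc]
        · gcongr
          exact ih (by omega)
        · rw [uIcc_of_le hi0, uIcc_of_le ht]
          exact Icc_subset_Icc le_rfl (hle.trans hit)
        · rw [uIcc_of_le hle, uIcc_of_le ht]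
          exact Icc_subset_Icc hi0 hit
    have := ind n le_rfl
    rwa [hnh] at this
  have hlim : Tendsto (fun n : ℕ => ∫ s in (0 : ℝ)..t, g (t / (n + 1 : ℕ)) s) atTop
      (𝓝 (∫ s in (0 : ℝ)..t, 2 * Real.exp (-(2 * lam * s)) * inner ℝ (z s) (F s))) := by
    refine intervalIntegral.tendsto_integral_filter_of_dominated_convergence
      (fun s => 2 * Z * Real.exp (lam * t) * ‖F s‖) (.of_forall fun n => hgm _ _ _)
      (.of_forall fun n => .of_forall fun s hs => ?_) ((hF 0 t).norm.const_mul _)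
      (.of_forall fun s hs => ?_)
    · rw [uIoc_of_le ht] at hs
      have hn1 : (1 : ℝ) ≤ (n + 1 : ℕ) := by push_cast; linarith [Nat.cast_nonneg (α := ℝ) n]
      exact hgb (n := n + 1) (by positivity) (div_le_self ht hn1) (by field_simp) hs
    · rw [uIoc_of_le ht] at hs
      have hs0 : 0 ≤ s := hs.1.le
      have hh : ∀ n : ℕ, 0 < t / (n + 1 : ℕ) := fun n => by positivity
      have hcs : Tendsto (fun n : ℕ => c (t / (n + 1 : ℕ)) s) atTop (𝓝 s) := by
        have l0 : Tendsto (fun n : ℕ => s + t / (n + 1 : ℕ)) atTop (𝓝 (s + 0)) :=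
          ((tendsto_const_div_atTop_nhds_zero_nat t).comp (tendsto_add_atTop_nat 1)).const_add s
        rw [add_zero] at l0
        exact tendsto_of_tendsto_of_tendsto_of_le_of_le tendsto_const_nhds l0
          (fun n => hcge (hh n)) (fun n => hclt (hh n) hs0)
      have l1 : Tendsto (fun n : ℕ => z (c (t / (n + 1 : ℕ)) s)) atTop (𝓝 (z s)) :=
        (hzc s hs0).tendsto.comp
          (tendsto_nhdsWithin_iff.2 ⟨hcs, .of_forall fun n => hc0 (hh n)⟩)
      have l2 : Tendsto (fun n : ℕ => P (c (t / (n + 1 : ℕ)) s - s) (F s)) atTop (𝓝 (F s)) := by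
        have := hP.cont.tendsto (0, F s)
        simp only [hP.zero, ContinuousLinearMap.id_apply] at this
        refine this.comp (f := fun n : ℕ => (c (t / (n + 1 : ℕ)) s - s, F s))
          (Tendsto.prodMk_nhds ?_ tendsto_const_nhds)
        simpa using hcs.sub_const s
      have l3 : Tendsto (fun n : ℕ => 2 * Real.exp (-(2 * lam * c (t / (n + 1 : ℕ)) s))) atTop
          (𝓝 (2 * Real.exp (-(2 * lam * s)))) := by
        have : Continuous fun c : ℝ => 2 * Real.exp (-(2 * lam * c)) := by fun_prop
        exact (this.tendsto s).comp hcs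
      exact l3.mul (l1.inner l2)
  exact le_of_tendsto_of_tendsto' tendsto_const_nhds (hlim.const_add _)
    fun n => hdisc (n + 1) (Nat.succ_pos n)

/-- Grönwall's inequality for mild solutions with a one-sided bound on the forcing. -/
theorem sq_norm_mildSol_le (hP : IsExpSemigroup P lam) {T : ℝ}
    (hF : ∀ a b, IntervalIntegrable F volume a b) {a b : ℝ → ℝ}
    (ha : IntervalIntegrable a volume 0 T) (hb : IntervalIntegrable b volume 0 T)
    (ha0 : ∀ s ∈ Icc 0 T, 0 ≤ a s) (hb0 : ∀ s ∈ Icc 0 T, 0 ≤ b s)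
    (h : ∀ s ∈ Icc 0 T, 2 * inner ℝ (mildSol P x F s) (F s) ≤ a s * ‖mildSol P x F s‖ ^ 2 + b s) :
    ∀ t ∈ Icc 0 T, ‖mildSol P x F t‖ ^ 2 ≤ Real.exp (2 * lam * t) *
      ((‖x‖ ^ 2 + ∫ s in (0 : ℝ)..T, b s) * Real.exp (∫ s in (0 : ℝ)..t, a s)) := by
  intro t ht
  have hT : 0 ≤ T := ht.1.trans ht.2
  have hlam := hP.nonneg
  have hzc := (hP.continuousOn_mildSol (x := x) hF).mono (Icc_subset_Ici_self : Icc 0 T ⊆ Ici 0)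
  have hen := fun {t : ℝ} (ht : 0 ≤ t) => hP.exp_mul_sq_norm_mildSol_le (x := x) ht hF
  generalize mildSol P x F = z at hzc hen h ⊢
  have hec : Continuous fun s => Real.exp (-(2 * lam * s)) := by fun_prop
  have sub : ∀ {s : ℝ}, s ∈ Icc 0 T → uIcc 0 s ⊆ uIcc 0 T := by
    intro s hs
    rw [uIcc_of_le hT]
    exact uIcc_subset_Icc ⟨le_rfl, hT⟩ hs
  have hB : 0 ≤ ‖x‖ ^ 2 + ∫ s in (0 : ℝ)..T, b s :=
    add_nonneg (by positivity) (intervalIntegral.integral_nonneg hT hb0)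
  have hφc : ContinuousOn (fun s => Real.exp (-(2 * lam * s)) * ‖z s‖ ^ 2) (Icc 0 T) :=
    hec.continuousOn.mul (hzc.norm.pow 2)
  -- The weight `exp (-2 lam s)` stays with `‖z s‖ ^ 2` to form the Grönwall function; on `b` it is
  -- bounded by `1`.
  have main := gronwall_integral_le (T := T) (B := ‖x‖ ^ 2 + ∫ s in (0 : ℝ)..T, b s) (a := a)
    (φ := fun s => Real.exp (-(2 * lam * s)) * ‖z s‖ ^ 2) hB ha ha0 hφc
    (fun s _ => by positivity) (fun t ht => by
      have hsub := sub ht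
      have hib : IntervalIntegrable b volume 0 t := hb.mono_set hsub
      have hia : IntervalIntegrable (fun s => a s * (Real.exp (-(2 * lam * s)) * ‖z s‖ ^ 2))
          volume 0 t := by
        refine IntervalIntegrable.mono_set (ha.mul_continuousOn ?_) hsub
        rwa [uIcc_of_le hT]
      have hiI : IntervalIntegrable
          (fun s => 2 * Real.exp (-(2 * lam * s)) * inner ℝ (z s) (F s)) volume 0 t := by
        have h1 : IntervalIntegrable (fun s => inner ℝ (z s) (F s)) volume 0 t := by
          obtain ⟨Z, hZ⟩ := isCompact_Icc.exists_bound_of_continuousOn hzc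
          refine ((hF 0 t).norm.const_mul Z).mono_fun ?_ ?_
          · refine AEStronglyMeasurable.inner ?_ (hF 0 t).aestronglyMeasurable_restrict_uIoc
            refine (hzc.mono ?_).aestronglyMeasurable measurableSet_uIoc
            rw [← uIcc_of_le hT]
            exact uIoc_subset_uIcc.trans hsub
          · refine (ae_restrict_iff' measurableSet_uIoc).2 (.of_forall fun s hs => ?_)
            rw [uIoc_of_le ht.1] at hs
            have := hZ s ⟨hs.1.le, hs.2.trans ht.2⟩
            refine (norm_inner_le_norm _ _).trans (le_trans ?_ (le_abs_self _))
            gcongr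
        exact h1.continuousOn_mul (by fun_prop)
      calc _ ≤ _ := hen ht.1
        _ ≤ ‖x‖ ^ 2 + ∫ s in (0 : ℝ)..t,
            (a s * (Real.exp (-(2 * lam * s)) * ‖z s‖ ^ 2) + b s) := by
          gcongr
          refine intervalIntegral.integral_mono_on ht.1 hiI (hia.add hib) fun s hs => ?_
          have hsI : s ∈ Icc 0 T := ⟨hs.1, hs.2.trans ht.2⟩
          have h1 : Real.exp (-(2 * lam * s)) ≤ 1 := by
            rw [Real.exp_le_one_iff]
            have : 0 ≤ lam * s := mul_nonneg hlam hs.1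
            linarith
          calc _ = Real.exp (-(2 * lam * s)) * (2 * inner ℝ (z s) (F s)) := by ring
            _ ≤ Real.exp (-(2 * lam * s)) * (a s * ‖z s‖ ^ 2 + b s) := by
              gcongr; exact h s hsI
            _ = a s * (Real.exp (-(2 * lam * s)) * ‖z s‖ ^ 2) +
                Real.exp (-(2 * lam * s)) * b s := by ring
            _ ≤ _ := by
              gcongr
              exact mul_le_of_le_one_left (hb0 s hsI) h1
        _ ≤ _ := by
          rw [intervalIntegral.integral_add hia hib]
          have : ∫ s in (0 : ℝ)..t, b s ≤ ∫ s in (0 : ℝ)..T, b s := by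
            rw [intervalIntegral.integral_of_le ht.1, intervalIntegral.integral_of_le hT]
            refine setIntegral_mono_set ((intervalIntegrable_iff_integrableOn_Ioc_of_le hT).1 hb)
              ((ae_restrict_iff' measurableSet_Ioc).2 (.of_forall fun s hs =>
                hb0 s ⟨hs.1.le, hs.2⟩)) (.of_forall (Ioc_subset_Ioc le_rfl ht.2))
          linarith) t ht
  calc ‖z t‖ ^ 2 = Real.exp (2 * lam * t) * (Real.exp (-(2 * lam * t)) * ‖z t‖ ^ 2) := by
        rw [← mul_assoc, ← Real.exp_add]; simp
    _ ≤ _ := by gcongr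

end IsExpSemigroup

/-! ### The exponential Euler scheme. -/

namespace IsExpSemigroup

variable {H : Type*} [NormedAddCommGroup H] [NormedSpace ℝ H] [CompleteSpace H]
  {P : ℝ → H →L[ℝ] H} {lam : ℝ} {x : H}

/-- The exponential Euler scheme: a mild solution driven by `G` along a path `y` that is
uniformly close to it. -/
theorem exists_approx_mildSol (hP : IsExpSemigroup P lam) (x : H) {T : ℝ} {G : ℝ → H → H}
    {k : ℝ → ℝ} (hk : ∀ a b, IntervalIntegrable k volume a b) (hGk : ∀ r x, ‖G r x‖ ≤ k r)
    (hGm : ∀ y : ℝ → H, StronglyMeasurable y →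
      AEStronglyMeasurable (fun r => G r (y r)) volume) {ε : ℝ} (hε : 0 < ε) :
    ∃ y : ℝ → H, StronglyMeasurable y ∧
      (∀ a b, IntervalIntegrable (fun r => G r (y r)) volume a b) ∧
      ∀ s ∈ Icc 0 T, ‖mildSol P x (fun r => G r (y r)) s - y s‖ ≤ ε := by
  have hlam := hP.nonneg
  have hk0 : ∀ r, 0 ≤ k r := fun r => (norm_nonneg _).trans (hGk r 0)
  have hUC : UniformContinuousOn (fun s => ∫ r in (0 : ℝ)..s, k r) (Icc 0 T) :=
    isCompact_Icc.uniformContinuousOn_of_continuous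
      (intervalIntegral.continuous_primitive hk 0).continuousOn
  -- The mesh `h < δ` makes `∫ k` over one step less than `ε / exp lam`; `h < 1` bounds the
  -- semigroup over one step by `exp lam`.
  obtain ⟨δ, hδ, hδk⟩ := Metric.uniformContinuousOn_iff.1 hUC (ε / Real.exp lam) (by positivity)
  obtain ⟨h, hh0, hhδ⟩ := exists_between (lt_min hδ one_pos)
  have hhδ' : h < δ := hhδ.trans_le (min_le_left _ _)
  have hh1 : h < 1 := hhδ.trans_le (min_le_right _ _)
  set X : ℕ → H := fun n => Nat.rec x (fun i v => P (((i + 1 : ℕ) : ℝ) * h - i * h) v +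
    ∫ r in (i * h)..((i + 1 : ℕ) * h),
      P ((i + 1 : ℕ) * h - r) (G r (P (r - i * h) v))) n with hX
  have hX0 : X 0 = x := rfl
  have hXs : ∀ i : ℕ, X (i + 1) = P (((i + 1 : ℕ) : ℝ) * h - i * h) (X i) +
    ∫ r in (i * h)..((i + 1 : ℕ) * h),
      P ((i + 1 : ℕ) * h - r) (G r (P (r - i * h) (X i))) := fun i => rfl
  clear_value X
  -- On each mesh interval the mesh value is transported by the semigroup rather than held constant.
  -- The error is then the forcing integral alone, small uniformly in the mesh value.
  set y : ℝ → H := fun r => P (r - (⌊r / h⌋₊ : ℝ) * h) (X ⌊r / h⌋₊) with hy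
  have hfl : Measurable fun r : ℝ => ⌊r / h⌋₊ :=
    Nat.measurable_floor.comp (measurable_id.div_const h)
  have hym : StronglyMeasurable y := by
    refine hP.cont.comp_stronglyMeasurable (f := fun r => (r - (⌊r / h⌋₊ : ℝ) * h, X ⌊r / h⌋₊))
      (StronglyMeasurable.prodMk ?_ ?_)
    · have : Measurable fun r : ℝ => (⌊r / h⌋₊ : ℝ) * h :=
        (measurable_from_nat (f := fun k : ℕ => (k : ℝ) * h)).comp hfl
      exact (measurable_id.sub this).stronglyMeasurable
    · exact (StronglyMeasurable.of_discrete (f := X)).comp_measurable hfl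
  have hFint : ∀ a b, IntervalIntegrable (fun r => G r (y r)) volume a b := fun a b =>
    (hk a b).mono_fun (hGm y hym).restrict
      (.of_forall fun r => (hGk r _).trans (le_abs_self _))
  have hgrid : ∀ i : ℕ, mildSol P x (fun r => G r (y r)) (i * h) = X i := by
    intro i
    induction i with
    | zero => simp [hP.mildSol_zero, hX0]
    | succ i ih =>
      have hle : (i : ℝ) * h ≤ (i + 1 : ℕ) * h := by gcongr; simp
      rw [hP.mildSol_eq_add (by positivity) hle hFint, ih, hXs]
      congr 1
      refine intervalIntegral.integral_congr_ae ?_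
      -- At the right endpoint the floor already jumps to `i + 1`; this is a null set.
      have : ∀ᵐ r ∂(volume : Measure ℝ), r ≠ (i + 1 : ℕ) * h := by
        simp [ae_iff, measure_singleton]
      filter_upwards [this] with r hr hr2
      rw [uIoc_of_le hle] at hr2
      have hr0 : 0 ≤ r := le_trans (by positivity) hr2.1.le
      have : ⌊r / h⌋₊ = i := by
        rw [Nat.floor_eq_iff (by positivity), le_div_iff₀ hh0, div_lt_iff₀ hh0]
        exact ⟨hr2.1.le, by simpa using lt_of_le_of_ne hr2.2 hr⟩
      simp only [hy]
      rw [this]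
  refine ⟨y, hym, hFint, fun s hs => ?_⟩
  set i := ⌊s / h⌋₊ with hi
  have hi1 : (i : ℝ) * h ≤ s := by
    have := Nat.floor_le (div_nonneg hs.1 hh0.le)
    rwa [le_div_iff₀ hh0] at this
  have hi2 : s < (i : ℝ) * h + h := by
    have := Nat.lt_floor_add_one (s / h)
    rw [div_lt_iff₀ hh0] at this
    linarith
  have hi0 : 0 ≤ (i : ℝ) * h := by positivity
  have hys : y s = P (s - i * h) (X i) := rfl
  rw [hP.mildSol_eq_add hi0 hi1 hFint, hgrid, hys, add_sub_cancel_left]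
  refine (hP.norm_integral_conv_le (hFint _ _) hi1 le_rfl).trans ?_
  have h1 : ∫ r in (i * h)..s, ‖G r (y r)‖ ≤ ∫ r in (i * h)..s, k r :=
    intervalIntegral.integral_mono_on hi1 (hFint _ _).norm (hk _ _) fun r _ => hGk _ _
  have h2 : ∫ r in (i * h)..s, k r ≤ ε / Real.exp lam := by
    have := hδk s hs (i * h) ⟨hi0, hi1.trans hs.2⟩
      (by rw [Real.dist_eq, abs_of_nonneg] <;> linarith)
    rw [Real.dist_eq, intervalIntegral.integral_interval_sub_left (hk _ _) (hk _ _)] at this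
    exact (le_abs_self _).trans this.le
  calc _ ≤ Real.exp lam * (ε / Real.exp lam) := by
        refine mul_le_mul ?_ (h1.trans h2) ?_ (by positivity)
        · gcongr
          nlinarith
        · exact intervalIntegral.integral_nonneg hi1 fun r _ => norm_nonneg _
    _ = ε := by field_simp

end IsExpSemigroup

/-! ### Growth, dissipativity and measurability of the drift. -/

section Drift

theorem norm_le_of_growth {H : Type*} [NormedAddCommGroup H] {f : H → H} {C : ℝ} {m : ℕ}
    (hf : ∀ x, ‖f x‖ ≤ C * (1 + ‖x‖ ^ m)) {x : H} {R : ℝ} (hx : ‖x‖ ≤ R) :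
    ‖f x‖ ≤ C * (1 + R ^ m) := by
  have hC : 0 ≤ C := by
    have := (norm_nonneg _).trans (hf 0)
    exact nonneg_of_mul_nonneg_left this (by positivity)
  exact (hf x).trans (by gcongr)

variable {H U : Type*} [NormedAddCommGroup H] [InnerProductSpace ℝ H]
  [NormedAddCommGroup U] [InnerProductSpace ℝ U]
  {f : H → H} {g : H → U →L[ℝ] H} {M D C : ℝ} {m : ℕ}

theorem opNorm_le_of_lipschitz (hg : ∀ x y, ‖g x - g y‖ ≤ D * ‖x - y‖) (x : H) :
    ‖g x‖ ≤ ‖g 0‖ + D * ‖x‖ := by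
  have h1 := hg x 0
  rw [sub_zero] at h1
  have := norm_add_le (g 0) (g x - g 0)
  rw [add_sub_cancel] at this
  linarith

theorem norm_drift_le (hf : ∀ x, ‖f x‖ ≤ C * (1 + ‖x‖ ^ m)) (hD : 0 ≤ D)
    (hg : ∀ x y, ‖g x - g y‖ ≤ D * ‖x - y‖) {x : H} {R : ℝ} (hx : ‖x‖ ≤ R) (v : U) :
    ‖f x + g x v‖ ≤ C * (1 + R ^ m) + (‖g 0‖ + D * R) * ‖v‖ := by
  refine (norm_add_le _ _).trans (add_le_add (norm_le_of_growth hf hx) ?_)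
  refine ((g x).le_opNorm v).trans ?_
  gcongr
  exact (opNorm_le_of_lipschitz hg x).trans (by gcongr)

/-- Compare with the drift at `0` and use Young's inequality, arranged so that `‖v‖ ^ 2` has
coefficient `1`, as the exponent of the a priori estimate requires. -/
theorem two_mul_inner_drift_le (hf : ∀ x y : H, inner ℝ (f x - f y) (x - y) ≤ M * ‖x - y‖ ^ 2)
    (hg : ∀ x y, ‖g x - g y‖ ≤ D * ‖x - y‖) (x : H) (v : U) :
    2 * inner ℝ x (f x + g x v) ≤
      (2 * M + 1 + 2 * D ^ 2 + ‖v‖ ^ 2) * ‖x‖ ^ 2 + (‖f 0‖ ^ 2 + 2 * ‖g 0‖ ^ 2) := by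
  have h1 : inner ℝ x (f x) ≤ M * ‖x‖ ^ 2 + ‖x‖ * ‖f 0‖ := by
    have e := hf x 0
    rw [sub_zero, inner_sub_left, real_inner_comm] at e
    have := real_inner_le_norm (f 0) x
    linarith
  have h2 : inner ℝ x (g x v) ≤ ‖x‖ * ((‖g 0‖ + D * ‖x‖) * ‖v‖) := by
    refine (real_inner_le_norm _ _).trans ?_
    gcongr
    exact ((g x).le_opNorm v).trans (by gcongr; exact opNorm_le_of_lipschitz hg x)
  rw [inner_add_right]
  nlinarith [sq_nonneg (‖x‖ - ‖f 0‖), sq_nonneg (‖v‖ * ‖x‖ - (‖g 0‖ + D * ‖x‖)),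
    sq_nonneg (‖g 0‖ - D * ‖x‖)]

/-- At a common control value no additive constant remains, so solutions can be compared by
Grönwall. -/
theorem inner_sub_drift_le (hf : ∀ x y : H, inner ℝ (f x - f y) (x - y) ≤ M * ‖x - y‖ ^ 2)
    (hg : ∀ x y, ‖g x - g y‖ ≤ D * ‖x - y‖) (x y : H) (v : U) :
    inner ℝ (x - y) ((f x + g x v) - (f y + g y v)) ≤ (M + D * ‖v‖) * ‖x - y‖ ^ 2 := by
  have e : (f x + g x v) - (f y + g y v) = (f x - f y) + (g x - g y) v := by
    simp only [sub_apply]; abel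
  have h2 : inner ℝ (x - y) ((g x - g y) v) ≤ ‖x - y‖ * ((D * ‖x - y‖) * ‖v‖) := by
    refine (real_inner_le_norm _ _).trans ?_
    gcongr
    exact ((g x - g y).le_opNorm v).trans (by gcongr; exact hg x y)
  rw [e, inner_add_right]
  have := hf x y
  rw [real_inner_comm] at this
  nlinarith

theorem continuous_of_lipschitz (hg : ∀ x y, ‖g x - g y‖ ≤ D * ‖x - y‖) : Continuous g := by
  refine (LipschitzWith.of_dist_le_mul (K := D.toNNReal) fun x y => ?_).continuous
  rw [dist_eq_norm, dist_eq_norm]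
  exact (hg x y).trans (by gcongr; exact Real.le_coe_toNNReal D)

/-- `f` need not be norm continuous, so its part relies on measurability of demicontinuous maps; the
`g` part is continuous in the pair (operator, vector). -/
theorem aestronglyMeasurable_drift [CompleteSpace H] [TopologicalSpace.SeparableSpace H]
    (hf : IsDemicontinuous f) (hg : Continuous g) {μ : Measure ℝ} {y : ℝ → H} {u : ℝ → U}
    (hy : AEStronglyMeasurable y μ) (hu : AEStronglyMeasurable u μ) :
    AEStronglyMeasurable (fun s => f (y s) + g (y s) (u s)) μ := by
  borelize H
  refine AEStronglyMeasurable.add ?_ ?_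
  · obtain ⟨y', hy', hyy'⟩ := hy
    exact ⟨fun s => f (y' s), hf.stronglyMeasurable.comp_measurable hy'.measurable,
      hyy'.mono fun s hs => by simp only [hs]⟩
  · exact isBoundedBilinearMap_apply.continuous.comp_aestronglyMeasurable
      ((hg.comp_aestronglyMeasurable hy).prodMk hu)

end Drift

/-! ### Existence by convergence of the approximations. -/

section Existence

variable {H U : Type*} [NormedAddCommGroup H] [InnerProductSpace ℝ H] [CompleteSpace H]
  [NormedAddCommGroup U] [InnerProductSpace ℝ U]
  {P : ℝ → H →L[ℝ] H} {lam : ℝ} {f : H → H} {g : H → U →L[ℝ] H} {M D C T : ℝ} {m : ℕ} {u : ℝ → U}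

namespace IsExpSemigroup

/-- Approximate mild solutions with an a priori bound that does not depend on the accuracy. -/
theorem exists_bounded_approx_mildSol [TopologicalSpace.SeparableSpace H]
    (hP : IsExpSemigroup P lam) (x : H) (hT : 0 ≤ T)
    (hf_demi : IsDemicontinuous f) (hf_growth : ∀ x, ‖f x‖ ≤ C * (1 + ‖x‖ ^ m)) (hM : 0 ≤ M)
    (hf_mono : ∀ x y : H, inner ℝ (f x - f y) (x - y) ≤ M * ‖x - y‖ ^ 2) (hD : 0 ≤ D)
    (hg : ∀ x y, ‖g x - g y‖ ≤ D * ‖x - y‖) (hu : AEStronglyMeasurable u volume)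
    (hu1 : ∀ a b, IntervalIntegrable (fun s => ‖u s‖) volume a b)
    (hu2 : ∀ a b, IntervalIntegrable (fun s => ‖u s‖ ^ 2) volume a b) :
    ∃ R : ℝ, 0 ≤ R ∧ ∀ ε > 0, ∃ y F : ℝ → H, (∀ a b, IntervalIntegrable F volume a b) ∧
      ∀ s ∈ Icc 0 T, ‖y s‖ ≤ R ∧ F s = f (y s) + g (y s) (u s) ∧
        ‖mildSol P x F s - y s‖ ≤ ε := by
  have hlam := hP.nonneg
  set c := 2 * M + 1 + 2 * D ^ 2 with hc
  set c' := ‖f 0‖ ^ 2 + 2 * ‖g 0‖ ^ 2 with hc'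
  have hc0 : 0 ≤ c := by positivity
  have hc'0 : 0 ≤ c' := by positivity
  -- The drift estimate holds at `y`, while Grönwall needs it at `z`. The factor `2` comes from `‖y‖
  -- ^ 2 ≤ 2 ‖z‖ ^ 2 + 2`, valid when `‖z - y‖ ≤ 1`; its constant term puts `a` into the source term
  -- of `B`.
  set a : ℝ → ℝ := fun s => 2 * (c + ‖u s‖ ^ 2) with ha
  have ha0 : ∀ s, 0 ≤ a s := fun s => by positivity
  have hai : ∀ r t, IntervalIntegrable a volume r t := fun r t =>
    ((intervalIntegrable_const).add (hu2 r t)).const_mul 2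
  set B := Real.exp (2 * lam * T) * ((‖x‖ ^ 2 + ((∫ s in (0 : ℝ)..T, (a s + c')) + 2)) *
    Real.exp (∫ s in (0 : ℝ)..T, a s)) with hB
  have hi1 : 0 ≤ ∫ s in (0 : ℝ)..T, (a s + c') :=
    intervalIntegral.integral_nonneg hT fun s _ => add_nonneg (ha0 s) hc'0
  have hB0 : 0 ≤ B := by positivity
  -- `B` does not involve the truncation radius, so there is no circularity; the extra `1` covers
  -- `‖z - y‖ ≤ ε ≤ 1`.
  set R := √B + 1 with hR
  have hR0 : 0 ≤ R := by positivity
  refine ⟨R, hR0, fun ε₀ hε₀ => ?_⟩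
  set k : ℝ → ℝ := fun s => C * (1 + R ^ m) + (‖g 0‖ + D * R) * ‖u s‖ with hk
  have hki : ∀ r t, IntervalIntegrable k volume r t := fun r t =>
    (intervalIntegrable_const).add ((hu1 r t).const_mul _)
  have hCR : 0 ≤ C * (1 + R ^ m) :=
    (norm_nonneg _).trans (norm_le_of_growth hf_growth (x := 0) (by simpa using hR0))
  have hk0 : ∀ s, 0 ≤ k s := fun s => by positivity
  set J := ∫ s in (0 : ℝ)..T, k s with hJ
  have hJ0 : 0 ≤ J := intervalIntegral.integral_nonneg hT fun s _ => hk0 s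
  -- This makes the error `2 ε ∫ k` at most `2`, the allowance built into `B`.
  set ε := min ε₀ (1 / (1 + J)) with hε
  have hε0 : 0 < ε := by positivity
  have hεJ : ε * J ≤ 1 := by
    have : ε ≤ 1 / (1 + J) := min_le_right _ _
    rw [le_div_iff₀ (by positivity)] at this
    nlinarith
  have hε1 : ε ≤ 1 := (min_le_right _ _).trans (div_le_one_of_le₀ (by linarith) (by positivity))
  -- The truncated drift is dominated by `k`. Where it vanishes, the dissipativity estimate is
  -- trivial, so the a priori bound holds before the truncation is known to be inactive.
  set G : ℝ → H → H := fun r => (Metric.closedBall 0 R).indicator fun x => f x + g x (u r) with hG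
  have hGmem : ∀ r {z : H}, ‖z‖ ≤ R → G r z = f z + g z (u r) := fun r z hz =>
    indicator_of_mem (mem_closedBall_zero_iff.2 hz) _
  have hGnot : ∀ r {z : H}, ¬ ‖z‖ ≤ R → G r z = 0 := fun r z hz =>
    indicator_of_notMem (fun h => hz (mem_closedBall_zero_iff.1 h)) _
  have hGk : ∀ r z, ‖G r z‖ ≤ k r := by
    intro r z
    by_cases hz : ‖z‖ ≤ R
    · rw [hGmem r hz]
      exact norm_drift_le hf_growth hD hg hz _
    · rw [hGnot r hz, norm_zero]
      exact hk0 r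
  have hGm : ∀ y : ℝ → H, StronglyMeasurable y →
      AEStronglyMeasurable (fun r => G r (y r)) volume := by
    intro y hy
    have e : (fun r => G r (y r)) =
        {r | ‖y r‖ ≤ R}.indicator fun r => f (y r) + g (y r) (u r) := by
      funext r
      by_cases hz : ‖y r‖ ≤ R
      · rw [hGmem r hz, indicator_of_mem (show r ∈ {r | ‖y r‖ ≤ R} from hz)]
      · rw [hGnot r hz, indicator_of_notMem (show r ∉ {r | ‖y r‖ ≤ R} from hz)]
    rw [e]
    exact (aestronglyMeasurable_drift hf_demi (continuous_of_lipschitz hg)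
      hy.aestronglyMeasurable hu).indicator (hy.norm.measurable measurableSet_Iic)
  obtain ⟨y, -, hFi, hy⟩ := hP.exists_approx_mildSol x (T := T) hki hGk hGm hε0
  set F : ℝ → H := fun r => G r (y r) with hF
  set z := mildSol P x F with hz
  have hbound : ∀ s ∈ Icc 0 T, ‖z s‖ ^ 2 ≤ B := by
    intro t ht
    have := hP.sq_norm_mildSol_le (x := x) (T := T) hFi (a := a)
      (b := fun s => (a s + c') + 2 * ε * k s) (hai 0 T)
      (((hai 0 T).add intervalIntegrable_const).add ((hki 0 T).const_mul _))
      (fun s _ => ha0 s) (fun s _ => by have := ha0 s; have := hk0 s; positivity)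
      (fun s hs => ?_) t ht
    · refine this.trans ?_
      have e1 : ∫ s in (0 : ℝ)..t, a s ≤ ∫ s in (0 : ℝ)..T, a s := by
        rw [← intervalIntegral.integral_add_adjacent_intervals (hai 0 t) (hai t T)]
        have := intervalIntegral.integral_nonneg (μ := volume) ht.2 fun s (_ : s ∈ Icc t T) => ha0 s
        linarith
      have e2 : ∫ s in (0 : ℝ)..T, (a s + c' + 2 * ε * k s) ≤
          (∫ s in (0 : ℝ)..T, (a s + c')) + 2 := by
        rw [intervalIntegral.integral_add ((hai 0 T).add intervalIntegrable_const)
          ((hki 0 T).const_mul _), intervalIntegral.integral_const_mul]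
        linarith
      have e3 : lam * t ≤ lam * T := by gcongr; exact ht.2
      have e4 : Real.exp (2 * lam * t) ≤ Real.exp (2 * lam * T) := Real.exp_le_exp.2 (by linarith)
      have e5 : 0 ≤ ∫ s in (0 : ℝ)..T, (a s + c' + 2 * ε * k s) :=
        intervalIntegral.integral_nonneg hT fun s _ => by
          have := ha0 s; have := hk0 s; positivity
      rw [hB]
      gcongr
    · have hys := hy s hs
      change ‖z s - y s‖ ≤ ε at hys
      have hFk : ‖F s‖ ≤ k s := hGk s _
      have e1 : 2 * inner ℝ (z s - y s) (F s) ≤ 2 * ε * k s := by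
        have : inner ℝ (z s - y s) (F s) ≤ ε * k s :=
          (real_inner_le_norm _ _).trans (by gcongr)
        linarith
      have e2 : 2 * inner ℝ (y s) (F s) ≤ (c + ‖u s‖ ^ 2) * ‖y s‖ ^ 2 + c' := by
        by_cases hz : ‖y s‖ ≤ R
        · rw [show F s = f (y s) + g (y s) (u s) from hGmem s hz]
          exact two_mul_inner_drift_le hf_mono hg _ _
        · rw [show F s = 0 from hGnot s hz, inner_zero_right, mul_zero]
          positivity
      have e3 : ‖y s‖ ^ 2 ≤ 2 * ‖z s‖ ^ 2 + 2 := by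
        have : ‖y s‖ ≤ ‖z s‖ + ‖z s - y s‖ := by
          have := norm_sub_le (z s) (z s - y s)
          rwa [sub_sub_cancel] at this
        nlinarith [norm_nonneg (y s), norm_nonneg (z s), norm_nonneg (z s - y s),
          sq_nonneg (‖z s‖ - 1)]
      have e4 : inner ℝ (z s) (F s) = inner ℝ (z s - y s) (F s) + inner ℝ (y s) (F s) := by
        rw [← inner_add_left, sub_add_cancel]
      change 2 * inner ℝ (z s) (F s) ≤ a s * ‖z s‖ ^ 2 + _
      rw [e4]
      have e5 : (c + ‖u s‖ ^ 2) * ‖y s‖ ^ 2 ≤ (c + ‖u s‖ ^ 2) * (2 * ‖z s‖ ^ 2 + 2) := by gcongr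
      simp only [ha]
      linarith
  have hyR : ∀ s ∈ Icc 0 T, ‖y s‖ ≤ R := by
    intro s hs
    have h1 : ‖z s‖ ≤ √B := Real.le_sqrt_of_sq_le (hbound s hs)
    have h2 := hy s hs
    change ‖z s - y s‖ ≤ ε at h2
    have := norm_sub_le (z s) (z s - y s)
    rw [sub_sub_cancel] at this
    linarith
  exact ⟨y, F, hFi, fun s hs => ⟨hyR s hs, hGmem s (hyR s hs),
    (hy s hs).trans (min_le_left _ _)⟩⟩

/-- Stability: two approximate mild solutions are close. -/
theorem exists_sq_norm_mildSol_sub_le (hP : IsExpSemigroup P lam) (x : H)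
    (hf_growth : ∀ x, ‖f x‖ ≤ C * (1 + ‖x‖ ^ m)) (hM : 0 ≤ M)
    (hf_mono : ∀ x y : H, inner ℝ (f x - f y) (x - y) ≤ M * ‖x - y‖ ^ 2) (hD : 0 ≤ D)
    (hg : ∀ x y, ‖g x - g y‖ ≤ D * ‖x - y‖)
    (hu1 : ∀ a b, IntervalIntegrable (fun s => ‖u s‖) volume a b) {R : ℝ} (hR : 0 ≤ R) :
    ∃ Q : ℝ, 0 ≤ Q ∧ ∀ (η : ℝ) (y y' F F' : ℝ → H), 0 ≤ η → η ≤ 2 →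
      (∀ a b, IntervalIntegrable F volume a b) → (∀ a b, IntervalIntegrable F' volume a b) →
      (∀ s ∈ Icc 0 T, ‖y s‖ ≤ R ∧ F s = f (y s) + g (y s) (u s)) →
      (∀ s ∈ Icc 0 T, ‖y' s‖ ≤ R ∧ F' s = f (y' s) + g (y' s) (u s)) →
      (∀ s ∈ Icc 0 T, ‖mildSol P x F s - y s‖ + ‖mildSol P x F' s - y' s‖ ≤ η) →
      ∀ t ∈ Icc 0 T, ‖mildSol P x F t - mildSol P x F' t‖ ^ 2 ≤ Q * η := by
  have hlam := hP.nonneg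
  rcases lt_or_ge T 0 with hT | hT
  · exact ⟨0, le_rfl, fun _ _ _ _ _ _ _ _ _ _ _ _ t ht =>
      absurd (ht.1.trans ht.2) (not_le.2 hT)⟩
  set k : ℝ → ℝ := fun s => C * (1 + R ^ m) + (‖g 0‖ + D * R) * ‖u s‖ with hk
  have hki : ∀ r t, IntervalIntegrable k volume r t := fun r t =>
    (intervalIntegrable_const).add ((hu1 r t).const_mul _)
  have hCR : 0 ≤ C * (1 + R ^ m) :=
    (norm_nonneg _).trans (norm_le_of_growth hf_growth (x := 0) (by simpa using hR))
  have hk0 : ∀ s, 0 ≤ k s := fun s => by positivity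
  -- For `η ≤ 2` the path difference `d` and solution difference `w` satisfy `‖d‖ ^ 2 ≤ 2 ‖w‖ ^ 2 +
  -- 4 η`. This gives the coefficient `a` and the part `2 a` of `b`; the part `4 k` comes from `⟪w -
  -- d, F - F'⟫`.
  set a : ℝ → ℝ := fun s => 4 * (M + D * ‖u s‖) with ha
  have ha0 : ∀ s, 0 ≤ a s := fun s => by positivity
  have hai : ∀ r t, IntervalIntegrable a volume r t := fun r t =>
    ((intervalIntegrable_const).add ((hu1 r t).const_mul D)).const_mul 4
  set b : ℝ → ℝ := fun s => 2 * a s + 4 * k s with hb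
  have hb0 : ∀ s, 0 ≤ b s := fun s => by have := ha0 s; have := hk0 s; positivity
  have hbi : ∀ r t, IntervalIntegrable b volume r t := fun r t =>
    ((hai r t).const_mul 2).add ((hki r t).const_mul 4)
  have hib : 0 ≤ ∫ s in (0 : ℝ)..T, b s := intervalIntegral.integral_nonneg hT fun s _ => hb0 s
  refine ⟨Real.exp (2 * lam * T) * ((∫ s in (0 : ℝ)..T, b s) *
    Real.exp (∫ s in (0 : ℝ)..T, a s)), by positivity, ?_⟩
  intro η y y' F F' hη hη2 hFi hFi' hy hy' hyη t ht
  have hsub : ∀ s ∈ Icc 0 T, mildSol P 0 (fun r => F r - F' r) s =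
      mildSol P x F s - mildSol P x F' s := fun s hs => by
    rw [hP.mildSol_sub hs.1 (hFi _ _) (hFi' _ _), sub_self]
  -- Equal initial values cancel, so only the source term `η b` contributes and the bound is linear
  -- in `η`.
  have := hP.sq_norm_mildSol_le (x := (0 : H)) (T := T) (F := fun r => F r - F' r)
    (fun r t => (hFi r t).sub (hFi' r t)) (a := a) (b := fun s => η * b s) (hai 0 T)
    ((hbi 0 T).const_mul _) (fun s _ => ha0 s) (fun s _ => mul_nonneg hη (hb0 s))
    (fun s hs => ?_) t ht
  · rw [hsub t ht, intervalIntegral.integral_const_mul] at this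
    refine this.trans ?_
    have e1 : ∫ s in (0 : ℝ)..t, a s ≤ ∫ s in (0 : ℝ)..T, a s := by
      rw [← intervalIntegral.integral_add_adjacent_intervals (hai 0 t) (hai t T)]
      have := intervalIntegral.integral_nonneg (μ := volume) ht.2 fun s (_ : s ∈ Icc t T) => ha0 s
      linarith
    have e3 : lam * t ≤ lam * T := by gcongr; exact ht.2
    have e4 : Real.exp (2 * lam * t) ≤ Real.exp (2 * lam * T) := Real.exp_le_exp.2 (by linarith)
    calc _ ≤ Real.exp (2 * lam * T) * ((‖(0 : H)‖ ^ 2 + η * ∫ s in (0 : ℝ)..T, b s) *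
          Real.exp (∫ s in (0 : ℝ)..T, a s)) := by gcongr
      _ = _ := by rw [norm_zero]; ring
  · rw [hsub s hs]
    have h3 := hyη s hs
    set w := mildSol P x F s - mildSol P x F' s with hw
    set d := y s - y' s with hd
    have he : ‖w - d‖ ≤ η := by
      have : w - d = (mildSol P x F s - y s) - (mildSol P x F' s - y' s) := by
        rw [hw, hd]; abel
      rw [this]
      exact (norm_sub_le _ _).trans h3
    have hFF : ‖F s - F' s‖ ≤ 2 * k s := by
      refine (norm_sub_le _ _).trans ?_
      have h4 : ‖F s‖ ≤ k s := by
        rw [(hy s hs).2]; exact norm_drift_le hf_growth hD hg (hy s hs).1 _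
      have h5 : ‖F' s‖ ≤ k s := by
        rw [(hy' s hs).2]; exact norm_drift_le hf_growth hD hg (hy' s hs).1 _
      linarith
    have e1 : inner ℝ (w - d) (F s - F' s) ≤ η * (2 * k s) :=
      (real_inner_le_norm _ _).trans (by gcongr)
    have e2 : inner ℝ d (F s - F' s) ≤ (M + D * ‖u s‖) * ‖d‖ ^ 2 := by
      rw [(hy s hs).2, (hy' s hs).2]
      exact inner_sub_drift_le hf_mono hg _ _ _
    have e3 : ‖d‖ ^ 2 ≤ 2 * ‖w‖ ^ 2 + 4 * η := by
      have : ‖d‖ ≤ ‖w‖ + ‖w - d‖ := by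
        have := norm_sub_le w (w - d)
        rwa [sub_sub_cancel] at this
      nlinarith [norm_nonneg d, norm_nonneg w, norm_nonneg (w - d), sq_nonneg (‖w‖ - η)]
    have e4 : inner ℝ w (F s - F' s) = inner ℝ (w - d) (F s - F' s) + inner ℝ d (F s - F' s) := by
      rw [← inner_add_left, sub_add_cancel]
    have e5 : (M + D * ‖u s‖) * ‖d‖ ^ 2 ≤ (M + D * ‖u s‖) * (2 * ‖w‖ ^ 2 + 4 * η) := by gcongr
    rw [e4]
    simp only [ha, hb]
    nlinarith

/-- Existence of mild solutions, as uniform limits of exponential Euler schemes. -/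
theorem exists_fixed_mildSol [TopologicalSpace.SeparableSpace H]
    (hP : IsExpSemigroup P lam) (x : H) (hT : 0 ≤ T)
    (hf_demi : IsDemicontinuous f) (hf_growth : ∀ x, ‖f x‖ ≤ C * (1 + ‖x‖ ^ m)) (hM : 0 ≤ M)
    (hf_mono : ∀ x y : H, inner ℝ (f x - f y) (x - y) ≤ M * ‖x - y‖ ^ 2) (hD : 0 ≤ D)
    (hg : ∀ x y, ‖g x - g y‖ ≤ D * ‖x - y‖) (hu : AEStronglyMeasurable u volume)
    (hu1 : ∀ a b, IntervalIntegrable (fun s => ‖u s‖) volume a b)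
    (hu2 : ∀ a b, IntervalIntegrable (fun s => ‖u s‖ ^ 2) volume a b) :
    ∃ z : ℝ → H, ContinuousOn z (Icc 0 T) ∧
      IntervalIntegrable (fun s => f (z s) + g (z s) (u s)) volume 0 T ∧
      ∀ t ∈ Icc 0 T, z t = mildSol P x (fun s => f (z s) + g (z s) (u s)) t := by
  have hlam := hP.nonneg
  obtain ⟨R, hR, happ⟩ := hP.exists_bounded_approx_mildSol x hT hf_demi hf_growth hM hf_mono hD hg
    hu hu1 hu2
  obtain ⟨Q, hQ, hstab⟩ := hP.exists_sq_norm_mildSol_sub_le (T := T) x hf_growth hM hf_mono hD hg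
    hu1 hR
  choose y F hFi hy using fun n : ℕ => happ (1 / ((n : ℝ) + 1)) (by positivity)
  set zz : ℕ → ℝ → H := fun n => mildSol P x (F n) with hzz
  have hle1 : ∀ {N n : ℕ}, N ≤ n → 1 / ((n : ℝ) + 1) ≤ 1 / ((N : ℝ) + 1) := fun h =>
    Nat.one_div_le_one_div h
  have hle2 : ∀ n : ℕ, 1 / ((n : ℝ) + 1) ≤ 1 := fun n => by
    simpa using hle1 (Nat.zero_le n)
  have hcau : UniformCauchySeqOn zz atTop (Icc 0 T) := by
    rw [Metric.uniformCauchySeqOn_iff]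
    intro ε hε
    have hlim : Tendsto (fun n : ℕ => Q * (2 * (1 / ((n : ℝ) + 1)))) atTop (𝓝 (Q * (2 * 0))) :=
      (tendsto_one_div_add_atTop_nhds_zero_nat.const_mul 2).const_mul Q
    rw [mul_zero, mul_zero] at hlim
    obtain ⟨N, hN⟩ := (hlim.eventually_lt_const (show (0 : ℝ) < ε ^ 2 by positivity)).exists
    refine ⟨N, fun p hp q hq t ht => ?_⟩
    have := hstab (2 * (1 / ((N : ℝ) + 1))) (y p) (y q) (F p) (F q) (by positivity)
      (by linarith [hle2 N]) (hFi p) (hFi q) (fun s hs => ⟨(hy p s hs).1, (hy p s hs).2.1⟩)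
      (fun s hs => ⟨(hy q s hs).1, (hy q s hs).2.1⟩)
      (fun s hs => by
        have h1 := (hy p s hs).2.2
        have h2 := (hy q s hs).2.2
        linarith [hle1 hp, hle1 hq]) t ht
    rw [dist_eq_norm]
    exact lt_of_pow_lt_pow_left₀ 2 hε.le (this.trans_lt hN)
  have hptlim : ∀ t, ∃ v, t ∈ Icc 0 T → Tendsto (fun n => zz n t) atTop (𝓝 v) := by
    intro t
    by_cases ht : t ∈ Icc 0 T
    · obtain ⟨v, hv⟩ := cauchySeq_tendsto_of_complete (hcau.cauchySeq ht)
      exact ⟨v, fun _ => hv⟩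
    · exact ⟨0, fun h => absurd h ht⟩
  choose z hz using hptlim
  have hunif : TendstoUniformlyOn zz z atTop (Icc 0 T) :=
    hcau.tendstoUniformlyOn_of_tendsto fun t ht => hz t ht
  have hzcont : ContinuousOn z (Icc 0 T) := hunif.continuousOn
    (Frequently.of_forall fun n => (hP.continuousOn_mildSol (hFi n)).mono Icc_subset_Ici_self)
  have hylim : ∀ s ∈ Icc 0 T, Tendsto (fun n => y n s) atTop (𝓝 (z s)) := by
    intro s hs
    have h1 : Tendsto (fun n => zz n s - y n s) atTop (𝓝 0) :=
      squeeze_zero_norm (fun n => (hy n s hs).2.2) tendsto_one_div_add_atTop_nhds_zero_nat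
    simpa using (hz s hs).sub h1
  have hzR : ∀ s ∈ Icc 0 T, ‖z s‖ ≤ R := fun s hs =>
    le_of_tendsto (hylim s hs).norm (.of_forall fun n => (hy n s hs).1)
  set k : ℝ → ℝ := fun s => C * (1 + R ^ m) + (‖g 0‖ + D * R) * ‖u s‖ with hk
  have hki : ∀ r t, IntervalIntegrable k volume r t := fun r t =>
    (intervalIntegrable_const).add ((hu1 r t).const_mul _)
  have hint : IntervalIntegrable (fun s => f (z s) + g (z s) (u s)) volume 0 T := by
    refine (hki 0 T).mono_fun (aestronglyMeasurable_drift hf_demi (continuous_of_lipschitz hg)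
      ((hzcont.mono ?_).aestronglyMeasurable measurableSet_uIoc) hu.restrict) ?_
    · rw [uIoc_of_le hT]; exact Ioc_subset_Icc_self
    · refine (ae_restrict_iff' measurableSet_uIoc).2 (.of_forall fun s hs => ?_)
      rw [uIoc_of_le hT] at hs
      exact (norm_drift_le hf_growth hD hg (hzR s (Ioc_subset_Icc_self hs)) _).trans
        (le_abs_self _)
  -- Demicontinuity gives only weak convergence of `f (y n s)`, so the equation is tested against
  -- `v`, with the semigroup moved onto `v` by the adjoint.
  refine ⟨z, hzcont, hint, fun t ht => ext_inner_left ℝ fun v => ?_⟩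
  have hint' : IntervalIntegrable (fun s => f (z s) + g (z s) (u s)) volume 0 t := by
    refine hint.mono_set ?_
    rw [uIcc_of_le hT]
    exact uIcc_subset_Icc ⟨le_rfl, hT⟩ ht
  have hexp : ∀ {F : ℝ → H}, IntervalIntegrable F volume 0 t → inner ℝ v (mildSol P x F t) =
      inner ℝ v (P t x) + ∫ s in (0 : ℝ)..t, inner ℝ v (P (t - s) (F s)) := by
    intro F hF
    rw [mildSol, inner_add_right]
    congr 1
    exact ((innerSL ℝ v).intervalIntegral_comp_comm
      (hP.intervalIntegrable_conv hF ht.1 le_rfl)).symm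
  rw [hexp hint']
  have l1 : Tendsto (fun n => inner ℝ v (zz n t)) atTop (𝓝 (inner ℝ v (z t))) :=
    tendsto_const_nhds.inner (hz t ht)
  refine tendsto_nhds_unique l1 ?_
  simp only [hzz, fun n => hexp (hFi n 0 t)]
  refine Tendsto.const_add _ ?_
  refine intervalIntegral.tendsto_integral_filter_of_dominated_convergence
    (fun s => ‖v‖ * (Real.exp (lam * t) * k s)) (.of_forall fun n => ?_)
    (.of_forall fun n => .of_forall fun s hs => ?_) (((hki 0 t).const_mul _).const_mul _)
    (.of_forall fun s hs => ?_)
  · exact aestronglyMeasurable_const.inner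
      (hP.aestronglyMeasurable_conv (hFi n 0 t).aestronglyMeasurable_restrict_uIoc t)
  · rw [uIoc_of_le ht.1] at hs
    have hsI : s ∈ Icc 0 T := ⟨hs.1.le, hs.2.trans ht.2⟩
    refine (norm_inner_le_norm _ _).trans ?_
    gcongr
    refine (hP.norm_apply_le (b := t) (by linarith [hs.2]) (by linarith [hs.1]) _).trans ?_
    gcongr
    rw [(hy n s hsI).2.1]
    exact norm_drift_le hf_growth hD hg (hy n s hsI).1 _
  · rw [uIoc_of_le ht.1] at hs
    have hsI : s ∈ Icc 0 T := ⟨hs.1.le, hs.2.trans ht.2⟩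
    simp only [← ContinuousLinearMap.adjoint_inner_left, fun n => (hy n s hsI).2.1,
      inner_add_right]
    refine Tendsto.add ?_ ?_
    · have := hf_demi _ _ (hylim s hsI) (ContinuousLinearMap.adjoint (P (t - s)) v)
      simpa only [real_inner_comm] using this
    · refine tendsto_const_nhds.inner ?_
      have hc : Continuous fun x => g x (u s) :=
        (continuous_of_lipschitz hg).clm_apply continuous_const
      exact (hc.tendsto _).comp (hylim s hsI)

end IsExpSemigroup

end Existence

/-! ### From the extended semigroup back to mild solutions, and the theorem. -/

section Main

variable {H U : Type*} [NormedAddCommGroup H] [InnerProductSpace ℝ H]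
  [NormedAddCommGroup U] [InnerProductSpace ℝ U]
  {S : ℝ → H →L[ℝ] H} {lam : ℝ} {f : H → H} {g : H → U →L[ℝ] H} {M D C T : ℝ} {m : ℕ}
  {u : ℝ → U} {X₀ : H} {z F : ℝ → H}

/-- Only times `t - s ≥ 0` occur, so the extension of `S` to negative times plays no role. -/
theorem mildSol_max_eq {t : ℝ} (ht : t ∈ Icc 0 T)
    (hF : ∀ s ∈ Icc 0 T, F s = f (z s) + g (z s) (u s)) :
    mildSol (fun t => S (max t 0)) X₀ F t =
      S t X₀ + ∫ s in (0 : ℝ)..t, S (t - s) (f (z s) + g (z s) (u s)) := by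
  simp only [mildSol, max_eq_left ht.1]
  congr 1
  refine intervalIntegral.integral_congr fun s hs => ?_
  rw [uIcc_of_le ht.1] at hs
  simp only [max_eq_left (sub_nonneg.2 hs.2)]
  rw [hF s ⟨hs.1, hs.2.trans ht.2⟩]

/-- A control in `L²` on `[0, T]` has a continuous mild solution. -/
theorem exists_isMildSolution [CompleteSpace H] [TopologicalSpace.SeparableSpace H]
    (hP : IsExpSemigroup (fun t => S (max t 0)) lam) (hT : 0 ≤ T)
    (hf_demi : IsDemicontinuous f) (hf_growth : ∀ x, ‖f x‖ ≤ C * (1 + ‖x‖ ^ m)) (hM : 0 ≤ M)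
    (hf_mono : ∀ x y : H, inner ℝ (f x - f y) (x - y) ≤ M * ‖x - y‖ ^ 2) (hD : 0 ≤ D)
    (hg : ∀ x y, ‖g x - g y‖ ≤ D * ‖x - y‖)
    (hu : MemLp u 2 (volume.restrict (Icc 0 T))) : ∃ z, IsMildSolution T S f g X₀ u z := by
  -- Extension by zero gives integrability on every interval, which the scheme requires, without
  -- changing the equation on `[0, T]`.
  set v := (Icc 0 T).indicator u with hv
  have hvL : MemLp v 2 volume := (memLp_indicator_iff_restrict measurableSet_Icc).2 hu
  have hv2 : Integrable (fun s => ‖v s‖ ^ 2) volume :=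
    (memLp_two_iff_integrable_sq_norm hvL.1).1 hvL
  have hv1 : ∀ a b, IntervalIntegrable (fun s => ‖v s‖) volume a b := fun a b => by
    refine ((intervalIntegrable_const (c := (1 : ℝ))).add hv2.intervalIntegrable).mono_fun
      hvL.1.norm.restrict (.of_forall fun s => ?_)
    refine (norm_norm (v s)).le.trans (le_trans ?_ (le_abs_self _))
    change ‖v s‖ ≤ 1 + ‖v s‖ ^ 2
    nlinarith [sq_nonneg (‖v s‖ - 1)]
  obtain ⟨z, hzc, hzi, hz⟩ := hP.exists_fixed_mildSol X₀ hT hf_demi hf_growth hM hf_mono hD hg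
    hvL.1 hv1 (fun a b => hv2.intervalIntegrable)
  have hF : ∀ s ∈ Icc 0 T, f (z s) + g (z s) (v s) = f (z s) + g (z s) (u s) := fun s hs => by
    rw [hv, indicator_of_mem hs]
  refine ⟨z, hzc, fun t ht => ?_, fun t ht => ?_⟩
  · have h1 : IntervalIntegrable (fun s => f (z s) + g (z s) (v s)) volume 0 t := by
      refine hzi.mono_set ?_
      rw [uIcc_of_le hT]
      exact uIcc_subset_Icc ⟨le_rfl, hT⟩ ht
    refine (hP.intervalIntegrable_conv h1 ht.1 le_rfl).congr fun s hs => ?_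
    rw [uIoc_of_le ht.1] at hs
    simp only [max_eq_left (sub_nonneg.2 hs.2)]
    rw [hF s ⟨hs.1.le, hs.2.trans ht.2⟩]
  · rw [hz t ht, mildSol_max_eq ht hF]

/-- A priori estimate for mild solutions. -/
theorem IsMildSolution.sq_norm_le [CompleteSpace H] [TopologicalSpace.SeparableSpace H]
    (hP : IsExpSemigroup (fun t => S (max t 0)) lam) (hT : 0 ≤ T)
    (hf_demi : IsDemicontinuous f) (hf_growth : ∀ x, ‖f x‖ ≤ C * (1 + ‖x‖ ^ m)) (hM : 0 ≤ M)
    (hf_mono : ∀ x y : H, inner ℝ (f x - f y) (x - y) ≤ M * ‖x - y‖ ^ 2) (hD : 0 ≤ D)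
    (hg : ∀ x y, ‖g x - g y‖ ≤ D * ‖x - y‖)
    (hu : MemLp u 2 (volume.restrict (Icc 0 T))) (hz : IsMildSolution T S f g X₀ u z) :
    ∀ t ∈ Icc 0 T, ‖z t‖ ^ 2 ≤ (‖X₀‖ ^ 2 + T * (‖f 0‖ ^ 2 + 2 * ‖g 0‖ ^ 2)) *
      Real.exp ((2 * lam + (2 * M + 1 + 2 * D ^ 2)) * t + ∫ s in (0 : ℝ)..t, ‖u s‖ ^ 2) := by
  have hu2 : IntegrableOn (fun s => ‖u s‖ ^ 2) (Icc 0 T) volume :=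
    (memLp_two_iff_integrable_sq_norm hu.1).1 hu
  have hu1 : IntegrableOn (fun s => ‖u s‖) (Icc 0 T) volume :=
    (hu.integrable (by norm_num)).norm
  have hu2i : IntervalIntegrable (fun s => ‖u s‖ ^ 2) volume 0 T :=
    (intervalIntegrable_iff_integrableOn_Icc_of_le hT).2 hu2
  obtain ⟨R, hR⟩ := isCompact_Icc.exists_bound_of_continuousOn hz.continuousOn
  have hG : IntegrableOn (fun s => f (z s) + g (z s) (u s)) (Icc 0 T) volume := by
    refine Integrable.mono' (g := fun s => C * (1 + R ^ m) + (‖g 0‖ + D * R) * ‖u s‖)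
      ((integrableOn_const (by simp)).add (hu1.const_mul _))
      (aestronglyMeasurable_drift hf_demi (continuous_of_lipschitz hg)
        (hz.continuousOn.aestronglyMeasurable measurableSet_Icc) hu.1) ?_
    exact (ae_restrict_iff' measurableSet_Icc).2
      (.of_forall fun s hs => norm_drift_le hf_growth hD hg (hR s hs) _)
  set F := (Icc 0 T).indicator fun s => f (z s) + g (z s) (u s) with hFdef
  have hF : ∀ s ∈ Icc 0 T, F s = f (z s) + g (z s) (u s) := fun s hs => indicator_of_mem hs _
  have hFi : ∀ a b, IntervalIntegrable F volume a b := fun a b =>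
    ((integrable_indicator_iff measurableSet_Icc).2 hG).intervalIntegrable
  -- Once its own drift is regarded as a given forcing, an arbitrary mild solution falls under the
  -- linear energy estimate.
  have hzF : ∀ t ∈ Icc 0 T, mildSol (fun t => S (max t 0)) X₀ F t = z t := fun t ht => by
    rw [mildSol_max_eq ht hF, hz.eq t ht]
  intro t ht
  have hu2t : IntervalIntegrable (fun s => ‖u s‖ ^ 2) volume 0 t := by
    refine hu2i.mono_set ?_
    rw [uIcc_of_le hT]
    exact uIcc_subset_Icc ⟨le_rfl, hT⟩ ht
  have := hP.sq_norm_mildSol_le (x := X₀) (T := T) hFi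
    (a := fun s => 2 * M + 1 + 2 * D ^ 2 + ‖u s‖ ^ 2)
    (b := fun _ => ‖f 0‖ ^ 2 + 2 * ‖g 0‖ ^ 2) (intervalIntegrable_const.add hu2i)
    intervalIntegrable_const (fun s _ => by positivity) (fun s _ => by positivity)
    (fun s hs => by
      rw [hzF s hs, hF s hs]
      exact two_mul_inner_drift_le hf_mono hg _ _) t ht
  rw [hzF t ht, intervalIntegral.integral_add intervalIntegrable_const hu2t,
    intervalIntegral.integral_const, intervalIntegral.integral_const, sub_zero, sub_zero,
    smul_eq_mul, smul_eq_mul] at this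
  refine this.trans (le_of_eq ?_)
  rw [show (2 * lam + (2 * M + 1 + 2 * D ^ 2)) * t + ∫ s in (0 : ℝ)..t, ‖u s‖ ^ 2 =
    2 * lam * t + (t * (2 * M + 1 + 2 * D ^ 2) + ∫ s in (0 : ℝ)..t, ‖u s‖ ^ 2) by ring,
    Real.exp_add (2 * lam * t)]
  ring

end Main

theorem theorem3p1
    {H U : Type*}
    [NormedAddCommGroup H] [InnerProductSpace ℝ H] [CompleteSpace H]
    [TopologicalSpace.SeparableSpace H]
    [NormedAddCommGroup U] [InnerProductSpace ℝ U] [CompleteSpace U]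
    (T : ℝ) (hT : 0 < T)
    (A : H →ₗ.[ℝ] H) (hA_closed : A.IsClosed) (hA_dense : Dense (A.domain : Set H))
    (S : ℝ → H →L[ℝ] H) (hS : IsC0Semigroup S) (hAS : IsGenerator A S)
    (lam : ℝ) (hlam : 0 < lam) (hS_norm : ∀ t : ℝ, 0 ≤ t → ‖S t‖ ≤ Real.exp (lam * t))
    (f : H → H) (hf_demi : IsDemicontinuous f)
    (hf_growth : ∃ (m : ℕ) (C : ℝ), ∀ x : H, ‖f x‖ ≤ C * (1 + ‖x‖ ^ m))
    (M : ℝ) (hM : 0 ≤ M)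
    (hf_mono : ∀ x y : H, inner ℝ (f x - f y) (x - y) ≤ M * ‖x - y‖ ^ 2)
    (g : H → U →L[ℝ] H) (hg_HS : ∀ x : H, IsHilbertSchmidt (g x))
    (D : ℝ) (hg_lip : ∀ x y : H, hsNorm (g x - g y) ≤ ENNReal.ofReal (D * ‖x - y‖))
    (X₀ : H) :
    -- every square integrable control has a continuous mild solution
    (∀ u : ℝ → U, MemLp u 2 (volume.restrict (Icc 0 T)) →
      ∃ z : ℝ → H, IsMildSolution T S f g X₀ u z) ∧
    -- a priori estimate, with a constant that does not depend on the control
    (∃ C : ℝ, 0 < C ∧ ∀ u : ℝ → U, MemLp u 2 (volume.restrict (Icc 0 T)) →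
      ∀ z : ℝ → H, IsMildSolution T S f g X₀ u z →
        ∀ t ∈ Icc 0 T, ‖z t‖ ^ 2 ≤ C * Real.exp (∫ s in (0 : ℝ)..t, (C + ‖u s‖ ^ 2))) ∧
    -- solutions and the nonlinearities along them are bounded, uniformly over bounded sets of controls
    (∀ N : ℝ, ∃ K : ℝ, ∀ u : ℝ → U, MemLp u 2 (volume.restrict (Icc 0 T)) →
      (∫ s in (0 : ℝ)..T, ‖u s‖ ^ 2) ≤ N →
      ∀ z : ℝ → H, IsMildSolution T S f g X₀ u z →
        ∀ t ∈ Icc 0 T, ‖z t‖ ≤ K ∧ ‖f (z t)‖ ≤ K ∧ hsNorm (g (z t)) ≤ ENNReal.ofReal K) := by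
  obtain ⟨m, Cf, hgrow⟩ := hf_growth
  have hP := hS.isExpSemigroup hlam.le hS_norm
  -- The sign of `D` is not prescribed; `|D|` is also a Lipschitz constant.
  have hD : 0 ≤ |D| := abs_nonneg D
  have hg_hs : ∀ x y : H, hsNorm (g x - g y) ≤ ENNReal.ofReal (|D| * ‖x - y‖) := fun x y =>
    (hg_lip x y).trans (ENNReal.ofReal_le_ofReal (by gcongr; exact le_abs_self D))
  have hg : ∀ x y : H, ‖g x - g y‖ ≤ |D| * ‖x - y‖ := fun x y =>
    norm_le_of_hsNorm_le (by positivity) (hg_hs x y)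
  have apriori : ∃ C : ℝ, 0 < C ∧ ∀ u : ℝ → U, MemLp u 2 (volume.restrict (Icc 0 T)) →
      ∀ z : ℝ → H, IsMildSolution T S f g X₀ u z →
        ∀ t ∈ Icc 0 T, ‖z t‖ ^ 2 ≤ C * Real.exp (∫ s in (0 : ℝ)..t, (C + ‖u s‖ ^ 2)) := by
    have hc : 0 < 2 * lam + (2 * M + 1 + 2 * |D| ^ 2) := by positivity
    have hx : 0 ≤ ‖X₀‖ ^ 2 + T * (‖f 0‖ ^ 2 + 2 * ‖g 0‖ ^ 2) := by positivity
    -- The sum of prefactor and growth rate dominates each of them, so one constant serves in both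
    -- places.
    refine ⟨(‖X₀‖ ^ 2 + T * (‖f 0‖ ^ 2 + 2 * ‖g 0‖ ^ 2)) +
      (2 * lam + (2 * M + 1 + 2 * |D| ^ 2)), by positivity, fun u hu z hz t ht => ?_⟩
    have hu2 : IntervalIntegrable (fun s => ‖u s‖ ^ 2) volume 0 t := by
      refine IntervalIntegrable.mono_set ((intervalIntegrable_iff_integrableOn_Icc_of_le hT.le).2
        ((memLp_two_iff_integrable_sq_norm hu.1).1 hu)) ?_
      rw [uIcc_of_le hT.le]
      exact uIcc_subset_Icc ⟨le_rfl, hT.le⟩ ht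
    refine (hz.sq_norm_le hP hT.le hf_demi hgrow hM hf_mono hD hg hu t ht).trans ?_
    rw [intervalIntegral.integral_add intervalIntegrable_const hu2,
      intervalIntegral.integral_const, sub_zero, smul_eq_mul, mul_comm t]
    have := ht.1
    generalize 2 * lam + (2 * M + 1 + 2 * |D| ^ 2) = c at hc ⊢
    generalize ‖X₀‖ ^ 2 + T * (‖f 0‖ ^ 2 + 2 * ‖g 0‖ ^ 2) = b at hx ⊢
    gcongr <;> linarith
  refine ⟨fun u hu => exists_isMildSolution hP hT.le hf_demi hgrow hM hf_mono hD hg hu,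
    apriori, fun N => ?_⟩
  obtain ⟨C, hC, hap⟩ := apriori
  -- The a priori bound at time `T` with control energy `N`; `K` is then the sum of the bounds for
  -- the three quantities.
  set R := √(C * Real.exp (C * T + N)) with hR
  have hR0 : 0 ≤ R := Real.sqrt_nonneg _
  have hf0 : 0 ≤ Cf * (1 + R ^ m) :=
    (norm_nonneg _).trans (norm_le_of_growth hgrow (x := 0) (by simpa using hR0))
  have hg0 : 0 ≤ 2 * (|D| * R + (hsNorm (g 0)).toReal) := by positivity
  refine ⟨R + Cf * (1 + R ^ m) + 2 * (|D| * R + (hsNorm (g 0)).toReal),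
    fun u hu huN z hz t ht => ?_⟩
  have hu2 : IntervalIntegrable (fun s => ‖u s‖ ^ 2) volume 0 T :=
    (intervalIntegrable_iff_integrableOn_Icc_of_le hT.le).2
      ((memLp_two_iff_integrable_sq_norm hu.1).1 hu)
  have hzR : ‖z t‖ ≤ R := by
    refine Real.le_sqrt_of_sq_le ((hap u hu z hz t ht).trans ?_)
    gcongr
    calc ∫ s in (0 : ℝ)..t, (C + ‖u s‖ ^ 2) ≤ ∫ s in (0 : ℝ)..T, (C + ‖u s‖ ^ 2) :=
          intervalIntegral.integral_mono_interval le_rfl ht.1 ht.2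
            (.of_forall fun s => by positivity) (intervalIntegrable_const.add hu2)
      _ = C * T + ∫ s in (0 : ℝ)..T, ‖u s‖ ^ 2 := by
          rw [intervalIntegral.integral_add intervalIntegrable_const hu2,
            intervalIntegral.integral_const, sub_zero, smul_eq_mul, mul_comm T]
      _ ≤ _ := by gcongr
  refine ⟨by linarith, by linarith [norm_le_of_growth hgrow hzR], ?_⟩
  calc hsNorm (g (z t)) ≤ 2 * (hsNorm (g (z t) - g 0) + hsNorm (g 0)) := hsNorm_le_of_sub _ _
    _ ≤ 2 * (ENNReal.ofReal (|D| * R) + ENNReal.ofReal (hsNorm (g 0)).toReal) := by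
        gcongr
        · refine (hg_hs _ _).trans (ENNReal.ofReal_le_ofReal ?_)
          rw [sub_zero]
          gcongr
        · rw [ENNReal.ofReal_toReal (hg_HS 0).ne]
    _ = ENNReal.ofReal (2 * (|D| * R + (hsNorm (g 0)).toReal)) := by
        rw [← ENNReal.ofReal_add (by positivity) ENNReal.toReal_nonneg,
          ENNReal.ofReal_mul (by norm_num), ENNReal.ofReal_ofNat]
    _ ≤ _ := ENNReal.ofReal_le_ofReal (by linarith)
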